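/- Work in the polar-coordinate model of the hyperbolic plane $\mathbb{H}^2$ with pole $O$: a point $P$ has radius $r(P)=|OP|$ and angle $\varphi(P)$ around $O$, and $|PQ|$ denotes hyperbolic distance. Let $\mathcal S\subset\mathbb{H}^2$ be a finite set of sites. A Voronoi vertex is a point $V$ with at least three closest sites; these are its incident sites, they lie on its witness circle (centre $V$, no site inside), and the far point $V'$ is the point of the witness circle with the largest radius. For a sweep radius $\hat r$, the seen sites are those with $r(S)\le\hat r$. The beach ellipse of a seen site $S$ is $E_S=\{P: |PS|=\hat r-r(P)\}$. Its active part consists of those $P\in E_S$ for which no seen site $S'\ne S$ has a point $P'\in E_{S'}$ with $\varphi(P')=\varphi(P)$ and $r(P')>r(P)$. The beach curve $\mathcal B$ is the union of the active parts, and its intersections are the points of $\mathcal B$ that lie on the beach ellipses of two distinct seen sites. Let $\bar{\mathcal Q}$ consist of $0$, the radii of all sites, and the radii of the far points of all Voronoi vertices. Let $V\neq O$ be a Voronoi vertex with exactly three incident sites whose far point $V'$ is not a site. Let $(S_1,S_2,S_3)$ be the incident sites in the order in which they are met on the witness circle when it is traversed clockwise from $V'$, and let $r$ be the largest element of $\bar{\mathcal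 Q}$ that is smaller than $r(V')$ (it exists). Then $V$ is detected by a circle event at $\hat r=r(V')$: there are points $I_{12}\in E_{S_1}\cap E_{S_2}$ and $I_{23}\in E_{S_2}\cap E_{S_3}$, depending continuously on $\hat r\in[r,r(V')]$, such that $I_{12}=I_{23}=V$ at $\hat r=r(V')$ and such that for every $\hat r\in[r,r(V'))$ both are on the beach curve $\mathcal B$, are distinct, and are consecutive there: going counterclockwise around $O$ from $I_{12}$ to $I_{23}$, there is no intersection of $\mathcal B$ strictly between them, and every point of $\mathcal B$ strictly between them is in the active part of $E_{S_2}$. -/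

import Mathlib

namespace HypSweep

/-- The polar-coordinate model of the hyperbolic plane: the point with hyperbolic distance `r` to
the pole and angle `φ` to the polar axis is the complex number `r * exp (φ * I)`; the pole is `0`.
-/
abbrev Hyp : Type := ℂ

/-- The radial coordinate. -/
noncomputable def radius (P : Hyp) : ℝ := ‖P‖

/-- The angular coordinate, normalized to `(-π, π]` (and `0` at the pole).  It is only used up to
multiples of `2 * π`. -/
noncomputable def angle (P : Hyp) : ℝ := Complex.arg P

/-- The hyperbolic distance in polar coordinates. -/
noncomputable def hdist (A B : Hyp) : ℝ :=
  Real.arcosh (Real.cosh (radius A) * Real.cosh (radius B)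
    - Real.sinh (radius A) * Real.sinh (radius B) * Real.cos (angle A - angle B))

/-- An angle reduced to `[0, 2π)`. -/
noncomputable def mod2pi (θ : ℝ) : ℝ := toIcoMod Real.two_pi_pos 0 θ

/-- The angle, in `[0, 2π)`, from the ray `OP` to the ray `OQ` counterclockwise around the pole. -/
noncomputable def ccw (P Q : Hyp) : ℝ := mod2pi (angle Q - angle P)

/-- The point of the Poincaré disk that corresponds to `P`. -/
noncomputable def toDisk (P : Hyp) : ℂ :=
  (Real.tanh (radius P / 2) : ℂ) * Complex.exp ((angle P : ℂ) * Complex.I)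

/-- The direction at `V` of the hyperbolic ray from `V` through `P`: the argument of the image of
`P` under the orientation-preserving hyperbolic isometry `z ↦ (z - v) / (1 - conj v * z)` of the
Poincaré disk, which carries `V` to the centre. -/
noncomputable def direction (V P : Hyp) : ℝ :=
  Complex.arg ((toDisk P - toDisk V) / (1 - starRingEnd ℂ (toDisk V) * toDisk P))

/-- The hyperbolic angle at `V`, in `[0, 2π)`, from the ray `VA` to the ray `VB`, measured in
clockwise direction around `V`. -/
noncomputable def cwAngle (A V B : Hyp) : ℝ := mod2pi (direction V A - direction V B)

/-! ### Voronoi vertices -/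

/-- The sites that are closest to `V`. -/
def incidentSites (𝒮 : Finset Hyp) (V : Hyp) : Set Hyp :=
  {S | S ∈ 𝒮 ∧ ∀ T ∈ 𝒮, hdist V S ≤ hdist V T}

/-- A Voronoi vertex is a point with at least three closest sites, that is, the centre of a circle
with at least three sites on it and none inside. -/
def IsVoronoiVertex (𝒮 : Finset Hyp) (V : Hyp) : Prop := 3 ≤ (incidentSites 𝒮 V).ncard

/-- The circle around `V` through its closest sites. -/
def witnessCircle (𝒮 : Finset Hyp) (V : Hyp) : Set Hyp :=
  {Q | ∃ S ∈ incidentSites 𝒮 V, hdist V Q = hdist V S}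

/-- `V'` has the largest radial coordinate among the points of the witness circle of `V`. -/
def IsFarPoint (𝒮 : Finset Hyp) (V V' : Hyp) : Prop :=
  V' ∈ witnessCircle 𝒮 V ∧ ∀ Q ∈ witnessCircle 𝒮 V, radius Q ≤ radius V'

/-- `(S₁, S₂, S₃)` lists all incident sites of `V` in the order in which they are met on the
witness circle when it is traversed clockwise from the far point `V'`. -/
def IsIncidenceTuple (𝒮 : Finset Hyp) (V V' S₁ S₂ S₃ : Hyp) : Prop :=
  incidentSites 𝒮 V = {S₁, S₂, S₃} ∧
    cwAngle V' V S₁ < cwAngle V' V S₂ ∧ cwAngle V' V S₂ < cwAngle V' V S₃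

/-- The radii of the site events and of the true circle events, together with `0`. -/
def eventRadii (𝒮 : Finset Hyp) : Set ℝ :=
  {0} ∪ {q | ∃ S ∈ 𝒮, q = radius S} ∪
    {q | ∃ W W' : Hyp, IsVoronoiVertex 𝒮 W ∧ IsFarPoint 𝒮 W W' ∧ q = radius W'}

/-! ### The beach curve at sweep radius `t` -/

/-- The sites in the closed disk bounded by the sweep circle. -/
def seenSites (𝒮 : Finset Hyp) (t : ℝ) : Set Hyp := {S | S ∈ 𝒮 ∧ radius S ≤ t}

/-- The beach ellipse of `S`: the points at equal distance to `S` and to the sweep circle.  A point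
`P` inside the sweep circle has distance `t - radius P` to it.  If `radius S = t`, this is the
segment from the pole to `S`. -/
def beachEllipse (t : ℝ) (S : Hyp) : Set Hyp := {P | hdist P S = t - radius P}

/-- The active part of the beach ellipse of `S`: the points beyond which, on the same ray from the
pole, there is no point of the beach ellipse of another seen site.  (A ray meets the ellipse of `S`
itself only once, unless `S` is on the sweep circle, where that ellipse is a segment of a ray.) -/
def activePart (𝒮 : Finset Hyp) (t : ℝ) (S : Hyp) : Set Hyp :=
  {P | P ∈ beachEllipse t S ∧ ¬ ∃ S' ∈ seenSites 𝒮 t, S' ≠ S ∧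
    ∃ P' ∈ beachEllipse t S', angle P = angle P' ∧ radius P < radius P'}

/-- The beach curve. -/
def beachCurve (𝒮 : Finset Hyp) (t : ℝ) : Set Hyp := ⋃ S ∈ seenSites 𝒮 t, activePart 𝒮 t S

/-- The intersections of two beach ellipses that are on the beach curve. -/
def beachIntersections (𝒮 : Finset Hyp) (t : ℝ) : Set Hyp :=
  {P | P ∈ beachCurve 𝒮 t ∧ ∃ S ∈ seenSites 𝒮 t, ∃ T ∈ seenSites 𝒮 t, S ≠ T ∧
    P ∈ beachEllipse t S ∩ beachEllipse t T}

/-- In counterclockwise direction around the pole, the ray through `X` is met strictly after the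
one through `P` and strictly before the one through `Q`. -/
def StrictlyBetween (P X Q : Hyp) : Prop := 0 < ccw P X ∧ ccw P X < ccw P Q

/-- `P` and `Q` are distinct intersections on the beach curve, and `Q` is the next one after `P` in
counterclockwise direction. -/
def Consecutive (𝒮 : Finset Hyp) (t : ℝ) (P Q : Hyp) : Prop :=
  P ∈ beachIntersections 𝒮 t ∧ Q ∈ beachIntersections 𝒮 t ∧ P ≠ Q ∧
    ∀ X ∈ beachIntersections 𝒮 t, ¬ StrictlyBetween P X Q

end HypSweep

/-! In the hyperboloid model the beach ellipse of `S` is a conic with focus `O`: in direction `e`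
its radius is `artanh ((cosh t - cosh |OS|) / (sinh t - ⟪s, e⟫))`, where `s` are the space
coordinates of `S`. Comparing the ellipses of `S` and `T` in direction `e` thus amounts to the sign
of an affine function of `e` on the unit circle. It has two zeros, told apart by the sign of the
slope, which depend continuously on `t`.

The zeros that belong to `I₁₂` and `I₂₃` collide at `t = r(V')` in the direction of `V`, where the
clockwise order of the sites fixes the signs of the slopes. They do not collide earlier, since a
common point of the three ellipses is equidistant from the sites and thus equal to `V`. So on the
arc between them the ellipse of `S₂` is either outside the other two during the whole sweep, or
never. When the sweep circle reaches the last of `S₁` and `S₃`, the ellipse of that site is a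
segment and cannot be outside, which decides for the former.

At `t = r(V')` the ellipses of all other sites are strictly inside that of `S₂` in the direction of
`V`. If one of them reached the arc earlier, then it would at the last such radius either touch the
ellipse of `S₂` in the interior of the arc, which happens only for a site on the sweep circle, or
pass through `I₁₂` or `I₂₃`, which is then a Voronoi vertex with far point on the sweep circle. In
both cases that radius is an event, so it is at most `r`. -/

namespace HypSweep

open Filter Topology
open scoped RealInnerProductSpace

/-! ### Directions in the plane -/

lemma real_inner_eq_add (z w : ℂ) : ⟪z, w⟫ = z.re * w.re + z.im * w.im := by
  rw [Complex.inner, Complex.mul_re, Complex.conj_re, Complex.conj_im]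
  ring

lemma re_sq_add_im_sq (e : Circle) : (e : ℂ).re ^ 2 + (e : ℂ).im ^ 2 = 1 := by
  rw [← e.normSq_coe, Complex.normSq_apply, sq, sq]

/-- Coordinates with respect to the orthonormal frame `(e, I * e)`. -/
lemma inner_mul_inner_add_inner_I_mul (e : Circle) (z w : ℂ) :
    ⟪z, e⟫ * ⟪w, e⟫ + ⟪z, Complex.I * e⟫ * ⟪w, Complex.I * e⟫ = ⟪z, w⟫ := by
  simp only [real_inner_eq_add, Complex.I_mul_re, Complex.I_mul_im]
  linear_combination (z.re * w.re + z.im * w.im) * re_sq_add_im_sq e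

lemma inner_sq_add_inner_I_mul_sq (e : Circle) (z : ℂ) :
    ⟪z, e⟫ ^ 2 + ⟪z, Complex.I * e⟫ ^ 2 = ‖z‖ ^ 2 := by
  rw [sq, sq, inner_mul_inner_add_inner_I_mul, real_inner_self_eq_norm_sq]

lemma inner_circle_self (e : Circle) : ⟪(e : ℂ), e⟫ = 1 := by
  rw [real_inner_self_eq_norm_sq, e.norm_coe, one_pow]

lemma inner_circle_I_mul_self (e : Circle) : ⟪(e : ℂ), Complex.I * e⟫ = 0 := by
  simp only [real_inner_eq_add, Complex.I_mul_re, Complex.I_mul_im]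
  ring

lemma inner_circle_le_norm (z : ℂ) (e : Circle) : ⟪z, e⟫ ≤ ‖z‖ := by
  simpa only [e.norm_coe, mul_one] using real_inner_le_norm z (e : ℂ)

lemma inner_circle_le_one (e f : Circle) : ⟪(e : ℂ), f⟫ ≤ 1 :=
  (inner_circle_le_norm _ f).trans_eq e.norm_coe

lemma inner_circle_eq_one_iff {e f : Circle} : ⟪(e : ℂ), f⟫ = 1 ↔ e = f := by
  rw [inner_eq_one_iff_of_norm_eq_one e.norm_coe f.norm_coe, Circle.coe_inj]

/-- The direction of `P` as seen from the pole. For complex numbers it is the normalisation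
`z ↦ z / ‖z‖`, with the junk value `1` at `0`. -/
noncomputable def unitDir (P : Hyp) : Circle := Circle.exp (angle P)

lemma radius_nonneg (P : Hyp) : 0 ≤ radius P := norm_nonneg P

lemma radius_pos {P : Hyp} : 0 < radius P ↔ P ≠ 0 := norm_pos_iff

lemma radius_smul_unitDir (P : Hyp) : radius P • (unitDir P : ℂ) = P := by
  rw [unitDir, Circle.coe_exp, Complex.real_smul]
  exact Complex.norm_mul_exp_arg_mul_I P

lemma radius_smul_circle {ρ : ℝ} (hρ : 0 ≤ ρ) (e : Circle) : radius (ρ • (e : ℂ)) = ρ := by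
  rw [radius, norm_smul, e.norm_coe, mul_one, Real.norm_of_nonneg hρ]

lemma unitDir_smul_circle {ρ : ℝ} (hρ : 0 < ρ) (e : Circle) : unitDir (ρ • (e : ℂ)) = e := by
  rw [unitDir, angle, Complex.real_smul, Complex.arg_real_mul _ hρ, Circle.exp_arg]

lemma coe_unitDir {P : Hyp} (hP : P ≠ 0) : (unitDir P : ℂ) = P / radius P := by
  have hr : (radius P : ℂ) ≠ 0 := Complex.ofReal_ne_zero.2 (radius_pos.2 hP).ne'
  rw [eq_div_iff hr, mul_comm, ← Complex.real_smul, radius_smul_unitDir]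

lemma inner_unitDir (P Q : Hyp) :
    ⟪(unitDir P : ℂ), unitDir Q⟫ = Real.cos (angle P - angle Q) := by
  rw [real_inner_eq_add, unitDir, unitDir, Circle.coe_exp, Circle.coe_exp,
    Complex.exp_ofReal_mul_I_re, Complex.exp_ofReal_mul_I_re, Complex.exp_ofReal_mul_I_im,
    Complex.exp_ofReal_mul_I_im, Real.cos_sub]

lemma arg_unitDir (P : Hyp) : (unitDir P : ℂ).arg = angle P :=
  Circle.arg_exp (Complex.neg_pi_lt_arg P) (Complex.arg_le_pi P)

lemma unitDir_eq_unitDir_iff {P Q : Hyp} : unitDir P = unitDir Q ↔ angle P = angle Q :=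
  ⟨fun h => by rw [← arg_unitDir P, h, arg_unitDir Q], fun h => by rw [unitDir, h, unitDir]⟩

lemma continuousAt_unitDir {z : ℂ} (hz : z ≠ 0) : ContinuousAt unitDir z := by
  refine Topology.IsInducing.subtypeVal.continuousAt_iff.2 ?_
  have hdiv : ContinuousAt (fun P : ℂ => P / (radius P : ℂ)) z :=
    continuousAt_id.div (Complex.continuous_ofReal.comp continuous_norm).continuousAt
      (Complex.ofReal_ne_zero.2 (radius_pos.2 hz).ne')
  refine hdiv.congr ?_
  filter_upwards [isOpen_ne.mem_nhds hz] with P hP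
  exact (coe_unitDir hP).symm

/-! ### The hyperboloid model -/

/-- The time coordinate of `P` in the hyperboloid model. -/
noncomputable def timeCoord (P : Hyp) : ℝ := Real.cosh (radius P)

/-- The space coordinates of `P` in the hyperboloid model. -/
noncomputable def spaceCoord (P : Hyp) : ℂ := Real.sinh (radius P) • (unitDir P : ℂ)

lemma one_le_timeCoord (P : Hyp) : 1 ≤ timeCoord P := Real.one_le_cosh _

lemma sinh_radius_nonneg (P : Hyp) : 0 ≤ Real.sinh (radius P) :=
  Real.sinh_nonneg_iff.2 (radius_nonneg P)

lemma norm_spaceCoord (P : Hyp) : ‖spaceCoord P‖ = Real.sinh (radius P) := by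
  rw [spaceCoord, norm_smul, Circle.norm_coe, mul_one, Real.norm_of_nonneg (sinh_radius_nonneg P)]

lemma timeCoord_sq (P : Hyp) : timeCoord P ^ 2 = ‖spaceCoord P‖ ^ 2 + 1 := by
  rw [norm_spaceCoord, timeCoord, Real.cosh_sq]

lemma timeCoord_lt_cosh_iff {P : Hyp} {t : ℝ} (ht : 0 ≤ t) :
    timeCoord P < Real.cosh t ↔ radius P < t :=
  Real.cosh_strictMonoOn.lt_iff_lt (radius_nonneg P) ht

lemma timeCoord_lt_cosh {P : Hyp} {t : ℝ} (h : radius P < t) : timeCoord P < Real.cosh t :=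
  (timeCoord_lt_cosh_iff ((radius_nonneg P).trans h.le)).2 h

lemma timeCoord_smul_circle {ρ : ℝ} (hρ : 0 ≤ ρ) (e : Circle) :
    timeCoord (ρ • (e : ℂ)) = Real.cosh ρ := by
  rw [timeCoord, radius_smul_circle hρ]

lemma spaceCoord_smul_circle {ρ : ℝ} (hρ : 0 ≤ ρ) (e : Circle) :
    spaceCoord (ρ • (e : ℂ)) = Real.sinh ρ • (e : ℂ) := by
  rw [spaceCoord, radius_smul_circle hρ]
  rcases hρ.eq_or_lt with rfl | hpos
  · rw [Real.sinh_zero, zero_smul, zero_smul]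
  · rw [unitDir_smul_circle hpos]

lemma inner_spaceCoord_le_sinh (P : Hyp) (e : Circle) :
    ⟪spaceCoord P, e⟫ ≤ Real.sinh (radius P) :=
  (inner_circle_le_norm _ e).trans_eq (norm_spaceCoord P)

/-! ### Hyperbolic distance -/

lemma timeCoord_mul_sub_inner_eq (P Q : Hyp) :
    timeCoord P * timeCoord Q - ⟪spaceCoord P, spaceCoord Q⟫ =
      Real.cosh (radius P - radius Q) + Real.sinh (radius P) * Real.sinh (radius Q) *
        (1 - ⟪(unitDir P : ℂ), unitDir Q⟫) := by
  rw [spaceCoord, spaceCoord, real_inner_smul_left, real_inner_smul_right, Real.cosh_sub,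
    timeCoord, timeCoord]
  ring

lemma cosh_radius_sub_le (P Q : Hyp) : Real.cosh (radius P - radius Q) ≤
    timeCoord P * timeCoord Q - ⟪spaceCoord P, spaceCoord Q⟫ := by
  rw [timeCoord_mul_sub_inner_eq, le_add_iff_nonneg_right]
  exact mul_nonneg (mul_nonneg (sinh_radius_nonneg P) (sinh_radius_nonneg Q))
    (sub_nonneg.2 (inner_circle_le_one _ _))

lemma hdist_eq_arcosh (P Q : Hyp) :
    hdist P Q = Real.arcosh (timeCoord P * timeCoord Q - ⟪spaceCoord P, spaceCoord Q⟫) := by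
  rw [hdist, ← inner_unitDir, spaceCoord, spaceCoord, real_inner_smul_left, real_inner_smul_right,
    timeCoord, timeCoord, mul_assoc]

lemma cosh_hdist (P Q : Hyp) :
    Real.cosh (hdist P Q) = timeCoord P * timeCoord Q - ⟪spaceCoord P, spaceCoord Q⟫ := by
  rw [hdist_eq_arcosh, Real.cosh_arcosh ((Real.one_le_cosh _).trans (cosh_radius_sub_le P Q))]

lemma hdist_nonneg (P Q : Hyp) : 0 ≤ hdist P Q := by
  rw [hdist_eq_arcosh]
  exact Real.arcosh_nonneg ((Real.one_le_cosh _).trans (cosh_radius_sub_le P Q))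

lemma hdist_eq_of_cosh_eq {P Q : Hyp} {d : ℝ} (hd : 0 ≤ d)
    (h : timeCoord P * timeCoord Q - ⟪spaceCoord P, spaceCoord Q⟫ = Real.cosh d) :
    hdist P Q = d := by
  rw [hdist_eq_arcosh, h, Real.arcosh_cosh hd]

lemma abs_radius_sub_le_hdist (P Q : Hyp) : |radius P - radius Q| ≤ hdist P Q := by
  rw [← abs_of_nonneg (hdist_nonneg P Q), ← Real.cosh_le_cosh, cosh_hdist]
  exact cosh_radius_sub_le P Q

lemma hdist_smul_circle {ρ σ : ℝ} (hρ : 0 ≤ ρ) (hσ : 0 ≤ σ) (e : Circle) :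
    hdist (ρ • (e : ℂ)) (σ • (e : ℂ)) = |ρ - σ| := by
  refine hdist_eq_of_cosh_eq (abs_nonneg _) ?_
  rw [timeCoord_smul_circle hρ, timeCoord_smul_circle hσ, spaceCoord_smul_circle hρ,
    spaceCoord_smul_circle hσ, real_inner_smul_left, real_inner_smul_right, inner_circle_self,
    Real.cosh_abs, Real.cosh_sub, mul_one]

/-- Equality in the triangle inequality of the pole, `P` and `Q`. -/
lemma unitDir_eq_of_hdist_eq {P Q : Hyp} (hP : P ≠ 0) (hQ : Q ≠ 0)
    (h : hdist P Q = |radius P - radius Q|) : unitDir P = unitDir Q := by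
  have hcosh := cosh_hdist P Q
  rw [h, Real.cosh_abs, timeCoord_mul_sub_inner_eq, left_eq_add] at hcosh
  have hpos := mul_pos (Real.sinh_pos_iff.2 (radius_pos.2 hP)) (Real.sinh_pos_iff.2
    (radius_pos.2 hQ))
  exact inner_circle_eq_one_iff.1 (sub_eq_zero.1 ((mul_eq_zero.1 hcosh).resolve_left hpos.ne')).symm

lemma hdist_self (P : Hyp) : hdist P P = 0 := by
  conv_lhs => rw [← radius_smul_unitDir P]
  rw [hdist_smul_circle (radius_nonneg P) (radius_nonneg P), sub_self, abs_zero]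

lemma eq_of_hdist_eq_zero {P Q : Hyp} (h : hdist P Q = 0) : P = Q := by
  have hr : radius P = radius Q :=
    sub_eq_zero.1 (abs_nonpos_iff.1 (h ▸ abs_radius_sub_le_hdist P Q))
  by_cases hP : P = 0
  · rw [hP, eq_comm, ← norm_eq_zero]
    exact hr.symm.trans (norm_eq_zero.2 hP)
  · have hQ : Q ≠ 0 := radius_pos.1 (hr ▸ radius_pos.2 hP)
    rw [← radius_smul_unitDir P, ← radius_smul_unitDir Q, hr,
      unitDir_eq_of_hdist_eq hP hQ (by rw [h, hr, sub_self, abs_zero])]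

lemma hdist_pos {P Q : Hyp} (h : P ≠ Q) : 0 < hdist P Q :=
  (hdist_nonneg P Q).lt_of_ne fun h0 => h (eq_of_hdist_eq_zero h0.symm)

/-- The point at distance `d` from `W` in the direction away from the pole. -/
noncomputable def outward (W : Hyp) (d : ℝ) : Hyp := (radius W + d) • (unitDir W : ℂ)

lemma radius_outward (W : Hyp) {d : ℝ} (hd : 0 ≤ d) : radius (outward W d) = radius W + d :=
  radius_smul_circle (add_nonneg (radius_nonneg W) hd) _

lemma hdist_outward (W : Hyp) {d : ℝ} (hd : 0 ≤ d) : hdist W (outward W d) = d := by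
  have h := hdist_smul_circle (radius_nonneg W) (add_nonneg (radius_nonneg W) hd) (unitDir W)
  rwa [radius_smul_unitDir, sub_add_cancel_left, abs_neg, abs_of_nonneg hd] at h

lemma eq_outward_of_radius_eq {W Q : Hyp} (hW : W ≠ 0) (h : radius Q = radius W + hdist W Q) :
    Q = outward W (hdist W Q) := by
  have hd := hdist_nonneg W Q
  have hQ : Q ≠ 0 := radius_pos.1 (by linarith [radius_pos.2 hW])
  have hdir : unitDir W = unitDir Q :=
    unitDir_eq_of_hdist_eq hW hQ (by rw [h, sub_add_cancel_left, abs_neg, abs_of_nonneg hd])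
  rw [outward, ← h, hdir, radius_smul_unitDir]

/-! ### Tangent coordinates -/

/-- The component of `P`, in the hyperboloid model, along the tangent plane at `V`, with respect to
the orthonormal basis of that plane made of the direction away from the pole and the direction of
increasing angle. -/
noncomputable def tangentCoord (V P : Hyp) : ℂ :=
  ⟨timeCoord V * ⟪spaceCoord P, unitDir V⟫ - timeCoord P * Real.sinh (radius V),
    ⟪spaceCoord P, Complex.I * unitDir V⟫⟩

lemma cosh_hdist_eq_of_unitDir (V P : Hyp) : Real.cosh (hdist V P) =
    timeCoord V * timeCoord P - Real.sinh (radius V) * ⟪spaceCoord P, unitDir V⟫ := by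
  rw [cosh_hdist, spaceCoord, real_inner_smul_left, real_inner_comm]

/-- The hyperbolic law of cosines at `V`. -/
lemma cosh_hdist_eq_sub_inner_tangentCoord (V P Q : Hyp) : Real.cosh (hdist P Q) =
    Real.cosh (hdist V P) * Real.cosh (hdist V Q) - ⟪tangentCoord V P, tangentCoord V Q⟫ := by
  rw [cosh_hdist_eq_of_unitDir V P, cosh_hdist_eq_of_unitDir V Q,
    real_inner_eq_add (tangentCoord V P), tangentCoord, tangentCoord, cosh_hdist,
    ← inner_mul_inner_add_inner_I_mul (unitDir V)]
  have h := timeCoord_sq V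
  rw [norm_spaceCoord] at h
  linear_combination
    (⟪spaceCoord P, unitDir V⟫ * ⟪spaceCoord Q, unitDir V⟫ - timeCoord P * timeCoord Q) * h

lemma norm_tangentCoord (V P : Hyp) : ‖tangentCoord V P‖ = Real.sinh (hdist V P) := by
  have h := cosh_hdist_eq_sub_inner_tangentCoord V P P
  rw [hdist_self, Real.cosh_zero, real_inner_self_eq_norm_sq, ← sq, Real.cosh_sq] at h
  refine (sq_eq_sq₀ (norm_nonneg _) (Real.sinh_nonneg_iff.2 (hdist_nonneg V P))).1 ?_
  linear_combination h

lemma tangentCoord_injective (V : Hyp) : Function.Injective (tangentCoord V) := by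
  intro P Q h
  have hd : hdist V P = hdist V Q :=
    Real.sinh_injective (by rw [← norm_tangentCoord, h, norm_tangentCoord])
  have hcosh : Real.cosh (hdist P Q) = 1 := by
    rw [cosh_hdist_eq_sub_inner_tangentCoord V, h, real_inner_self_eq_norm_sq, norm_tangentCoord,
      hd, ← sq, Real.cosh_sq, add_sub_cancel_left]
  exact eq_of_hdist_eq_zero
    (Real.cosh_injOn (hdist_nonneg P Q) Set.self_mem_Ici (hcosh.trans Real.cosh_zero.symm))

lemma dist_tangentCoord_eq_of_equidistant {P W A B : Hyp} (hP : hdist P A = hdist P B)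
    (hW : hdist W A = hdist W B) :
    dist (tangentCoord P A) (tangentCoord P W) = dist (tangentCoord P B) (tangentCoord P W) := by
  have hA := cosh_hdist_eq_sub_inner_tangentCoord P W A
  have hB := cosh_hdist_eq_sub_inner_tangentCoord P W B
  rw [hW, hP] at hA
  rw [dist_eq_norm, dist_eq_norm, ← sq_eq_sq₀ (norm_nonneg _) (norm_nonneg _),
    norm_sub_sq_real, norm_sub_sq_real, norm_tangentCoord P A, norm_tangentCoord P B, hP,
    real_inner_comm, real_inner_comm (tangentCoord P W) (tangentCoord P B)]
  linear_combination 2 * (hB - hA)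

/-- In the tangent coordinates at `P`, circles around `P` are Euclidean circles around the origin,
and bisectors of points on such a circle are Euclidean bisectors. -/
lemma eq_of_equidistant {P W A B C : Hyp} (hAB : A ≠ B) (hAC : A ≠ C) (hBC : B ≠ C)
    (hPB : hdist P B = hdist P A) (hPC : hdist P C = hdist P A)
    (hWB : hdist W B = hdist W A) (hWC : hdist W C = hdist W A) : P = W := by
  by_contra hPW
  have hnorm (Q : Hyp) : dist (tangentCoord P Q) 0 = Real.sinh (hdist P Q) := by
    rw [dist_zero_right, norm_tangentCoord]
  have hcentres : 0 ≠ tangentCoord P W := fun h => (Real.sinh_pos_iff.2 (hdist_pos hPW)).ne' <| by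
    rw [← norm_tangentCoord, ← h, norm_zero]
  have hcollide := EuclideanGeometry.eq_of_dist_eq_of_dist_eq_of_finrank_eq_two
    Complex.finrank_real_complex hcentres ((tangentCoord_injective P).ne hAB) (hnorm A)
    ((hnorm B).trans (congrArg Real.sinh hPB)) ((hnorm C).trans (congrArg Real.sinh hPC)) rfl
    (dist_tangentCoord_eq_of_equidistant hPB hWB) (dist_tangentCoord_eq_of_equidistant hPC hWC)
  exact hcollide.elim (fun h => hAC (tangentCoord_injective P h).symm)
    fun h => hBC (tangentCoord_injective P h).symm

/-! ### Directions at a point -/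

lemma toDisk_eq_div (P : Hyp) : toDisk P = spaceCoord P / (1 + timeCoord P : ℝ) := by
  have htanh : Real.tanh (radius P / 2) = Real.sinh (radius P) / (1 + timeCoord P) := by
    have hcosh := Real.cosh_sq (radius P / 2)
    have hpos : 0 < Real.cosh (radius P / 2) := Real.cosh_pos _
    rw [timeCoord, Real.tanh_eq_sinh_div_cosh, ← mul_div_cancel₀ (radius P) two_ne_zero,
      Real.sinh_two_mul, Real.cosh_two_mul, mul_div_cancel_left₀ _ two_ne_zero,
      div_eq_div_iff hpos.ne' (by positivity)]
    linear_combination -Real.sinh (radius P / 2) * hcosh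
  rw [toDisk, htanh, spaceCoord, unitDir, Circle.coe_exp, Complex.real_smul, Complex.ofReal_div,
    div_mul_eq_mul_div]

lemma arg_div_eq_arg_mul_conj (z w : ℂ) : (z / w).arg = (z * starRingEnd ℂ w).arg := by
  rcases eq_or_ne w 0 with rfl | hw
  · simp
  · rw [div_eq_mul_inv, Complex.inv_def, ← mul_assoc, mul_comm,
      Complex.arg_real_mul _ (inv_pos.2 (Complex.normSq_pos.2 hw))]

lemma inner_add_inner_I_mul_I_mul_circle (z : ℂ) (e : Circle) :
    (⟪z, e⟫ + ⟪z, Complex.I * e⟫ * Complex.I) * e = z := by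
  have h := re_sq_add_im_sq e
  apply Complex.ext <;>
    simp only [real_inner_eq_add, Complex.mul_re, Complex.mul_im, Complex.add_re, Complex.add_im,
      Complex.ofReal_re, Complex.ofReal_im, Complex.I_re, Complex.I_im]
  · linear_combination z.re * h
  · linear_combination z.im * h

/-- The Möbius transformation in `direction`, in terms of hyperboloid coordinates and up to a
positive factor. -/
lemma spaceCoord_sub_mul_conj_eq (V P : Hyp) :
    ((1 + timeCoord V) * spaceCoord P - (1 + timeCoord P) * spaceCoord V) *
      starRingEnd ℂ
        ((1 + timeCoord P) * (1 + timeCoord V) - starRingEnd ℂ (spaceCoord V) * spaceCoord P) =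
    (2 * (1 + timeCoord P) * (1 + timeCoord V) : ℝ) * (tangentCoord V P * unitDir V) := by
  have hP : spaceCoord P * starRingEnd ℂ (spaceCoord P) = timeCoord P ^ 2 - 1 := by
    rw [Complex.mul_conj']
    exact_mod_cast eq_sub_of_add_eq (timeCoord_sq P).symm
  have hV : (Real.sinh (radius V) : ℂ) ^ 2 = timeCoord V ^ 2 - 1 := by
    rw [← norm_spaceCoord]
    exact_mod_cast eq_sub_of_add_eq (timeCoord_sq V).symm
  have hu : (unitDir V : ℂ) * starRingEnd ℂ (unitDir V : ℂ) = 1 := by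
    rw [Complex.mul_conj, Circle.normSq_coe, Complex.ofReal_one]
  have hframe := inner_add_inner_I_mul_I_mul_circle (spaceCoord P) (unitDir V)
  have hconj := congrArg (starRingEnd ℂ) hframe
  have htan : tangentCoord V P = (timeCoord V * ⟪spaceCoord P, unitDir V⟫ -
      timeCoord P * Real.sinh (radius V)) + ⟪spaceCoord P, Complex.I * unitDir V⟫ * Complex.I := by
    rw [tangentCoord, Complex.mk_eq_add_mul_I]
    push_cast
    rfl
  have hY : spaceCoord V = Real.sinh (radius V) * unitDir V := Complex.real_smul
  simp only [map_mul, map_add, map_sub, map_one, Complex.conj_ofReal, Complex.conj_I,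
    Complex.conj_conj] at hconj ⊢
  rw [htan, hY]
  push_cast [-Complex.ofReal_sinh]
  set u : ℂ := (unitDir V : ℂ)
  set X := spaceCoord P
  linear_combination (-(1 + timeCoord V : ℂ) * Real.sinh (radius V) * u) * hP +
    ((1 + timeCoord P : ℂ) * u ^ 2 * starRingEnd ℂ X) * hV +
    (1 + timeCoord P : ℂ) * (1 + timeCoord V) * (-(1 + timeCoord V) * hframe -
      (timeCoord V - 1) * u ^ 2 * hconj +
      (timeCoord V - 1) * u * (⟪X, u⟫ - ⟪X, Complex.I * u⟫ * Complex.I) * hu)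

lemma direction_eq_arg (V P : Hyp) : direction V P = (tangentCoord V P * unitDir V).arg := by
  have hpos (X : Hyp) : 0 < 1 + timeCoord X := by linarith [one_le_timeCoord X]
  have hne (X : Hyp) : (1 + timeCoord X : ℂ) ≠ 0 := by exact_mod_cast (hpos X).ne'
  have hquot : (toDisk P - toDisk V) / (1 - starRingEnd ℂ (toDisk V) * toDisk P) =
      ((1 + timeCoord V) * spaceCoord P - (1 + timeCoord P) * spaceCoord V) /
        ((1 + timeCoord P) * (1 + timeCoord V) - starRingEnd ℂ (spaceCoord V) * spaceCoord P) := by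
    rw [toDisk_eq_div, toDisk_eq_div, map_div₀, Complex.conj_ofReal,
      ← mul_div_mul_left _ _ (mul_ne_zero (hne P) (hne V))]
    have hP := hne P
    have hV := hne V
    congr 1 <;> push_cast <;> field_simp
  rw [direction, hquot, arg_div_eq_arg_mul_conj, spaceCoord_sub_mul_conj_eq,
    Complex.arg_real_mul _ (mul_pos (mul_pos two_pos (hpos P)) (hpos V))]

lemma tangentCoord_eq_smul (V P : Hyp) : tangentCoord V P =
    Real.sinh (hdist V P) • (Circle.exp (direction V P - angle V) : ℂ) := by
  have hpolar := radius_smul_unitDir (tangentCoord V P * unitDir V)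
  rw [radius, norm_mul, Circle.norm_coe, mul_one, norm_tangentCoord, unitDir, angle,
    ← direction_eq_arg] at hpolar
  rw [Circle.exp_sub, Circle.coe_div, ← smul_div_assoc, hpolar]
  exact (mul_div_cancel_right₀ _ (Circle.coe_ne_zero _)).symm

lemma direction_outward (V : Hyp) {R : ℝ} (hR : 0 < R) : direction V (outward V R) = angle V := by
  have hV := add_nonneg (radius_nonneg V) hR.le
  have htan : tangentCoord V (outward V R) = Real.sinh R := by
    rw [tangentCoord, outward, spaceCoord_smul_circle hV, timeCoord_smul_circle hV,
      real_inner_smul_left, real_inner_smul_left, inner_circle_self, inner_circle_I_mul_self,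
      timeCoord, mul_one, mul_zero, mul_comm, ← Real.sinh_sub, add_sub_cancel_left]
    rfl
  rw [direction_eq_arg, htan, Complex.arg_real_mul _ (Real.sinh_pos_iff.2 hR), arg_unitDir]

lemma exp_mod2pi (θ : ℝ) : Circle.exp (mod2pi θ) = Circle.exp θ :=
  Circle.periodic_exp.sub_zsmul_eq _

lemma mod2pi_mem_Ico (θ : ℝ) : mod2pi θ ∈ Set.Ico 0 (2 * Real.pi) :=
  toIcoMod_mem_Ico' Real.two_pi_pos θ

/-- The angle at `V`, in `[0, 2π)`, clockwise from the direction away from the pole to the direction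
of `S`. -/
noncomputable def clockAngle (V S : Hyp) : ℝ := mod2pi (angle V - direction V S)

lemma cwAngle_outward (V S : Hyp) {R : ℝ} (hR : 0 < R) :
    cwAngle (outward V R) V S = clockAngle V S := by
  rw [cwAngle, direction_outward V hR, clockAngle]

lemma tangentCoord_eq_clockAngle (V S : Hyp) : tangentCoord V S =
    ⟨Real.sinh (hdist V S) * Real.cos (clockAngle V S),
      -(Real.sinh (hdist V S) * Real.sin (clockAngle V S))⟩ := by
  have hdir : Circle.exp (direction V S - angle V) = Circle.exp (-clockAngle V S) := by
    rw [clockAngle, Circle.exp_neg, exp_mod2pi, ← Circle.exp_neg, neg_sub]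
  rw [tangentCoord_eq_smul, hdir, Circle.coe_exp]
  apply Complex.ext
  · rw [Complex.smul_re, Complex.exp_ofReal_mul_I_re, Real.cos_neg, smul_eq_mul]
  · rw [Complex.smul_im, Complex.exp_ofReal_mul_I_im, Real.sin_neg, smul_eq_mul, mul_neg]

lemma eq_of_hdist_eq_of_clockAngle_eq {V S T : Hyp} (hd : hdist V S = hdist V T)
    (hα : clockAngle V S = clockAngle V T) : S = T :=
  tangentCoord_injective V (by rw [tangentCoord_eq_clockAngle, tangentCoord_eq_clockAngle, hd, hα])

lemma timeCoord_eq_clockAngle (V S : Hyp) : timeCoord S =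
    timeCoord V * Real.cosh (hdist V S) +
      Real.sinh (radius V) * Real.sinh (hdist V S) * Real.cos (clockAngle V S) := by
  have hre : timeCoord V * ⟪spaceCoord S, unitDir V⟫ - timeCoord S * Real.sinh (radius V) =
      Real.sinh (hdist V S) * Real.cos (clockAngle V S) :=
    congrArg Complex.re (tangentCoord_eq_clockAngle V S)
  have hsq := timeCoord_sq V
  rw [norm_spaceCoord] at hsq
  linear_combination -timeCoord S * hsq - timeCoord V * cosh_hdist_eq_of_unitDir V S +
    Real.sinh (radius V) * hre

lemma inner_spaceCoord_I_mul_eq_clockAngle (V S : Hyp) :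
    ⟪spaceCoord S, Complex.I * unitDir V⟫ =
      -(Real.sinh (hdist V S) * Real.sin (clockAngle V S)) :=
  congrArg Complex.im (tangentCoord_eq_clockAngle V S)

lemma clockAngle_outward (V : Hyp) {R : ℝ} (hR : 0 < R) : clockAngle V (outward V R) = 0 := by
  rw [clockAngle, direction_outward V hR, sub_self, mod2pi, toIcoMod_apply_left]

lemma clockAngle_pos {V S : Hyp} (hd : 0 < hdist V S) (hne : S ≠ outward V (hdist V S)) :
    0 < clockAngle V S := by
  refine (mod2pi_mem_Ico _).1.lt_of_ne fun h => hne ?_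
  exact eq_of_hdist_eq_of_clockAngle_eq (hdist_outward V hd.le).symm
    (h.symm.trans (clockAngle_outward V hd).symm)

lemma sin_half_clockAngle_pos {V S : Hyp} (h : 0 < clockAngle V S) :
    0 < Real.sin (clockAngle V S / 2) := by
  have hlt : clockAngle V S < 2 * Real.pi := (mod2pi_mem_Ico _).2
  exact Real.sin_pos_of_pos_of_lt_pi (half_pos h) (by linarith)

lemma cosh_radius_add_sub_timeCoord (V S : Hyp) :
    Real.cosh (radius V + hdist V S) - timeCoord S =
      2 * Real.sinh (radius V) * Real.sinh (hdist V S) * Real.sin (clockAngle V S / 2) ^ 2 := by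
  rw [timeCoord_eq_clockAngle V S, Real.sin_sq_eq_half_sub, mul_div_cancel₀ _ two_ne_zero,
    Real.cosh_add, timeCoord]
  ring

lemma radius_lt_radius_add_hdist {V S : Hyp} (hV : V ≠ 0) (hd : 0 < hdist V S)
    (hα : 0 < clockAngle V S) : radius S < radius V + hdist V S := by
  have hv := Real.sinh_pos_iff.2 (radius_pos.2 hV)
  have hR := Real.sinh_pos_iff.2 hd
  have hsin := sin_half_clockAngle_pos hα
  rw [← timeCoord_lt_cosh_iff (add_nonneg (radius_nonneg V) hd.le), ← sub_pos,
    cosh_radius_add_sub_timeCoord]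
  exact mul_pos (mul_pos (mul_pos two_pos hv) hR) (pow_pos hsin 2)

lemma radius_lt_radius_of_sin_half_lt {V S T : Hyp} (hV : V ≠ 0) (hd : 0 < hdist V S)
    (hST : hdist V T = hdist V S) (hS : 0 < clockAngle V S)
    (h : Real.sin (clockAngle V S / 2) < Real.sin (clockAngle V T / 2)) :
    radius T < radius S := by
  have hv := Real.sinh_pos_iff.2 (radius_pos.2 hV)
  have hR := Real.sinh_pos_iff.2 hd
  have hsq := pow_lt_pow_left₀ h (sin_half_clockAngle_pos hS).le two_ne_zero
  have hlt := mul_lt_mul_of_pos_left hsq (mul_pos (mul_pos two_pos hv) hR)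
  have hT := cosh_radius_add_sub_timeCoord V T
  rw [hST] at hT
  rw [← cosh_radius_add_sub_timeCoord, ← hT, sub_lt_sub_iff_left] at hlt
  exact (timeCoord_lt_cosh_iff (radius_nonneg S)).1 hlt

/-- Half-angles are in `(0, π)`, where the sine is unimodal. -/
lemma radius_lt_max_of_clockAngle_lt {V S₁ S₂ S₃ : Hyp} (hV : V ≠ 0) (hd : 0 < hdist V S₂)
    (hd₁ : hdist V S₁ = hdist V S₂) (hd₃ : hdist V S₃ = hdist V S₂) (h₀ : 0 < clockAngle V S₁)
    (h₁₂ : clockAngle V S₁ < clockAngle V S₂) (h₂₃ : clockAngle V S₂ < clockAngle V S₃) :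
    radius S₂ < max (radius S₁) (radius S₃) := by
  have hlt : clockAngle V S₃ < 2 * Real.pi := (mod2pi_mem_Ico _).2
  rcases le_total (clockAngle V S₂) Real.pi with h | h
  · refine lt_max_of_lt_left (radius_lt_radius_of_sin_half_lt hV (hd₁ ▸ hd) hd₁.symm h₀ ?_)
    exact Real.sin_lt_sin_of_lt_of_le_pi_div_two (by linarith) (by linarith) (by linarith)
  · refine lt_max_of_lt_right (radius_lt_radius_of_sin_half_lt hV (hd₃ ▸ hd) hd₃.symm
      (h₀.trans (h₁₂.trans h₂₃)) ?_)
    rw [← Real.sin_pi_sub, ← Real.sin_pi_sub (clockAngle V S₂ / 2)]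
    exact Real.sin_lt_sin_of_lt_of_le_pi_div_two (by linarith) (by linarith) (by linarith)

/-! ### Witness circles and events -/

section VoronoiVertex

variable {𝒮 : Finset Hyp} {W W' S T Q : Hyp}

lemma hdist_eq_of_mem_incidentSites (hS : S ∈ incidentSites 𝒮 W) (hT : T ∈ incidentSites 𝒮 W) :
    hdist W S = hdist W T :=
  le_antisymm (hS.2 T hT.1) (hT.2 S hS.1)

lemma hdist_eq_of_mem_witnessCircle (hS : S ∈ incidentSites 𝒮 W) (hQ : Q ∈ witnessCircle 𝒮 W) :
    hdist W Q = hdist W S := by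
  obtain ⟨T, hT, h⟩ := hQ
  rw [h, hdist_eq_of_mem_incidentSites hT hS]

lemma isFarPoint_outward (hS : S ∈ incidentSites 𝒮 W) :
    IsFarPoint 𝒮 W (outward W (hdist W S)) := by
  refine ⟨⟨S, hS, hdist_outward W (hdist_nonneg W S)⟩, fun Q hQ => ?_⟩
  have h := (neg_le_abs _).trans (abs_radius_sub_le_hdist W Q)
  rw [hdist_eq_of_mem_witnessCircle hS hQ] at h
  rw [radius_outward W (hdist_nonneg W S)]
  linarith

lemma IsFarPoint.radius_eq (h : IsFarPoint 𝒮 W W') (hS : S ∈ incidentSites 𝒮 W) :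
    radius W' = radius W + hdist W S := by
  have hout := isFarPoint_outward hS
  rw [le_antisymm (hout.2 _ h.1) (h.2 _ hout.1), radius_outward W (hdist_nonneg W S)]

lemma IsFarPoint.eq_outward (h : IsFarPoint 𝒮 W W') (hS : S ∈ incidentSites 𝒮 W) (hW : W ≠ 0) :
    W' = outward W (hdist W S) := by
  have hd := hdist_eq_of_mem_witnessCircle hS h.1
  rw [← hd, ← eq_outward_of_radius_eq hW (by rw [hd, h.radius_eq hS])]

lemma finite_incidentSites (𝒮 : Finset Hyp) (W : Hyp) : (incidentSites 𝒮 W).Finite :=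
  𝒮.finite_toSet.subset fun _ hS => hS.1

lemma isVoronoiVertex_iff : IsVoronoiVertex 𝒮 W ↔
    ∃ A B C, A ≠ B ∧ A ≠ C ∧ B ≠ C ∧ {A, B, C} ⊆ incidentSites 𝒮 W := by
  constructor
  · intro h
    obtain ⟨T, hT, hcard⟩ := Set.exists_subset_card_eq h
    obtain ⟨A, B, C, hAB, hAC, hBC, rfl⟩ := Set.ncard_eq_three.1 hcard
    exact ⟨A, B, C, hAB, hAC, hBC, hT⟩
  · rintro ⟨A, B, C, hAB, hAC, hBC, h⟩
    rw [IsVoronoiVertex, ← Set.ncard_eq_three.2 ⟨A, B, C, hAB, hAC, hBC, rfl⟩]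
    exact Set.ncard_le_ncard h (finite_incidentSites 𝒮 W)

lemma injOn_incidentSites (𝒮 : Finset Hyp) :
    Set.InjOn (incidentSites 𝒮) {W | IsVoronoiVertex 𝒮 W} := by
  intro W hW U _ hWU
  obtain ⟨A, B, C, hAB, hAC, hBC, hsub⟩ := isVoronoiVertex_iff.1 hW
  simp only [Set.insert_subset_iff, Set.singleton_subset_iff] at hsub
  have hsubU := hWU ▸ hsub
  exact eq_of_equidistant hAB hAC hBC (hdist_eq_of_mem_incidentSites hsub.2.1 hsub.1)
    (hdist_eq_of_mem_incidentSites hsub.2.2 hsub.1)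
    (hdist_eq_of_mem_incidentSites hsubU.2.1 hsubU.1)
    (hdist_eq_of_mem_incidentSites hsubU.2.2 hsubU.1)

lemma finite_voronoiVertices (𝒮 : Finset Hyp) : {W | IsVoronoiVertex 𝒮 W}.Finite := by
  refine Set.Finite.of_finite_image (𝒮.finite_toSet.finite_subsets.subset ?_)
    (injOn_incidentSites 𝒮)
  rintro _ ⟨W, -, rfl⟩
  exact fun S hS => hS.1

lemma finite_eventRadii (𝒮 : Finset Hyp) : (eventRadii 𝒮).Finite := by
  refine ((Set.finite_singleton _).union ?_).union ?_
  · refine (𝒮.finite_toSet.image radius).subset ?_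
    rintro q ⟨S, hS, rfl⟩
    exact ⟨S, hS, rfl⟩
  · refine ((finite_voronoiVertices 𝒮).image fun W =>
      sSup (radius '' witnessCircle 𝒮 W)).subset ?_
    rintro q ⟨W, W', hW, ⟨hmem, hmax⟩, rfl⟩
    exact ⟨W, hW, IsGreatest.csSup_eq ⟨⟨W', hmem, rfl⟩, Set.forall_mem_image.2 hmax⟩⟩

lemma exists_isGreatest_eventRadii (𝒮 : Finset Hyp) {b : ℝ} (hb : 0 < b) :
    ∃ r, IsGreatest {q | q ∈ eventRadii 𝒮 ∧ q < b} r := by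
  have hfin : {q | q ∈ eventRadii 𝒮 ∧ q < b}.Finite :=
    (finite_eventRadii 𝒮).subset fun q hq => hq.1
  exact hfin.isCompact.exists_isGreatest ⟨0, Or.inl (Or.inl rfl), hb⟩

lemma radius_mem_eventRadii (hS : S ∈ 𝒮) : radius S ∈ eventRadii 𝒮 :=
  Or.inl (Or.inr ⟨S, hS, rfl⟩)

lemma radius_add_hdist_mem_eventRadii {A B C : Hyp} (hAB : A ≠ B) (hAC : A ≠ C) (hBC : B ≠ C)
    (h : {A, B, C} ⊆ incidentSites 𝒮 W) : radius W + hdist W A ∈ eventRadii 𝒮 :=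
  Or.inr ⟨W, _, isVoronoiVertex_iff.2 ⟨A, B, C, hAB, hAC, hBC, h⟩,
    isFarPoint_outward (h (Set.mem_insert A _)), (radius_outward W (hdist_nonneg W A)).symm⟩

end VoronoiVertex

/-! ### Beach ellipses -/

section Ellipse

variable {S : Hyp} {t ρ : ℝ}

lemma cosh_hdist_smul_circle_sub_cosh (hρ : 0 ≤ ρ) (e : Circle) (S : Hyp) (t : ℝ) :
    Real.cosh (hdist (ρ • (e : ℂ)) S) - Real.cosh (t - ρ) =
      Real.sinh ρ * (Real.sinh t - ⟪spaceCoord S, e⟫) -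
        Real.cosh ρ * (Real.cosh t - timeCoord S) := by
  rw [cosh_hdist, timeCoord_smul_circle hρ, spaceCoord_smul_circle hρ, real_inner_smul_left,
    real_inner_comm, Real.cosh_sub]
  ring

lemma cosh_sub_lt_sinh_sub {s t : ℝ} (h : s < t) :
    Real.cosh t - Real.cosh s < Real.sinh t - Real.sinh s := by
  have hexp : Real.exp (-t) < Real.exp (-s) := Real.exp_lt_exp.2 (neg_lt_neg h)
  rw [← Real.cosh_sub_sinh, ← Real.cosh_sub_sinh] at hexp
  linarith

lemma cosh_sub_timeCoord_pos (hS : radius S < t) : 0 < Real.cosh t - timeCoord S :=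
  sub_pos.2 (timeCoord_lt_cosh hS)

lemma cosh_sub_timeCoord_lt (hS : radius S < t) (e : Circle) :
    Real.cosh t - timeCoord S < Real.sinh t - ⟪spaceCoord S, e⟫ :=
  (cosh_sub_lt_sinh_sub hS).trans_le (sub_le_sub_left (inner_spaceCoord_le_sinh S e) _)

lemma sinh_sub_inner_pos (hS : radius S < t) (e : Circle) :
    0 < Real.sinh t - ⟪spaceCoord S, e⟫ :=
  (cosh_sub_timeCoord_pos hS).trans (cosh_sub_timeCoord_lt hS e)

/-- The hyperbolic tangent of the radius of the beach ellipse of `S` in direction `e`. -/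
noncomputable def ellipseRatio (t : ℝ) (S : Hyp) (e : Circle) : ℝ :=
  (Real.cosh t - timeCoord S) / (Real.sinh t - ⟪spaceCoord S, e⟫)

/-- The radius of the beach ellipse of `S` in direction `e`, meaningful if `S` is strictly inside
the sweep circle. -/
noncomputable def ellipseRadius (t : ℝ) (S : Hyp) (e : Circle) : ℝ :=
  Real.artanh (ellipseRatio t S e)

/-- The point of the beach ellipse of `S` in direction `e`. -/
noncomputable def ellipsePoint (t : ℝ) (S : Hyp) (e : Circle) : Hyp :=
  ellipseRadius t S e • (e : ℂ)

lemma ellipseRatio_mem_Ioo (hS : radius S < t) (e : Circle) :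
    ellipseRatio t S e ∈ Set.Ioo (0 : ℝ) 1 :=
  ⟨div_pos (cosh_sub_timeCoord_pos hS) (sinh_sub_inner_pos hS e),
    (div_lt_one (sinh_sub_inner_pos hS e)).2 (cosh_sub_timeCoord_lt hS e)⟩

lemma ellipseRadius_pos (hS : radius S < t) (e : Circle) : 0 < ellipseRadius t S e :=
  Real.artanh_pos (ellipseRatio_mem_Ioo hS e)

lemma eq_ellipseRadius_iff (hS : radius S < t) (e : Circle) : ρ = ellipseRadius t S e ↔
    Real.sinh ρ * (Real.sinh t - ⟪spaceCoord S, e⟫) =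
      Real.cosh ρ * (Real.cosh t - timeCoord S) := by
  have htanh : ρ = ellipseRadius t S e ↔ Real.tanh ρ = ellipseRatio t S e := by
    constructor
    · rintro rfl
      obtain ⟨hpos, hlt⟩ := ellipseRatio_mem_Ioo hS e
      exact Real.tanh_artanh ⟨neg_one_lt_zero.trans hpos, hlt⟩
    · intro h
      rw [ellipseRadius, ← h, Real.artanh_tanh]
  rw [htanh, ellipseRatio, Real.tanh_eq_sinh_div_cosh,
    div_eq_div_iff (Real.cosh_pos ρ).ne' (sinh_sub_inner_pos hS e).ne', mul_comm (Real.cosh ρ)]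

lemma smul_circle_mem_beachEllipse_iff (hS : radius S < t) (hρ : 0 ≤ ρ) (e : Circle) :
    ρ • (e : ℂ) ∈ beachEllipse t S ↔ ρ = ellipseRadius t S e := by
  have hformula := cosh_hdist_smul_circle_sub_cosh hρ e S t
  rw [eq_ellipseRadius_iff hS, ← sub_eq_zero, ← hformula, beachEllipse, Set.mem_ofPred_eq,
    radius_smul_circle hρ, sub_eq_zero]
  refine ⟨fun h => by rw [h], fun h => ?_⟩
  have habs : hdist (ρ • (e : ℂ)) S = |t - ρ| :=
    Real.cosh_injOn (Set.mem_Ici.2 (hdist_nonneg _ _)) (Set.mem_Ici.2 (abs_nonneg _))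
      (h.trans (Real.cosh_abs _).symm)
  have htri := abs_radius_sub_le_hdist (ρ • (e : ℂ)) S
  rw [radius_smul_circle hρ, habs] at htri
  have hle : ρ ≤ t := by
    by_contra hlt
    rw [abs_of_neg (sub_neg.2 (not_le.1 hlt))] at htri
    linarith [le_abs_self (ρ - radius S)]
  rw [habs, abs_of_nonneg (sub_nonneg.2 hle)]

lemma ellipsePoint_mem_beachEllipse (hS : radius S < t) (e : Circle) :
    ellipsePoint t S e ∈ beachEllipse t S :=
  (smul_circle_mem_beachEllipse_iff hS (ellipseRadius_pos hS e).le e).2 rfl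

lemma radius_ellipsePoint (hS : radius S < t) (e : Circle) :
    radius (ellipsePoint t S e) = ellipseRadius t S e :=
  radius_smul_circle (ellipseRadius_pos hS e).le e

lemma unitDir_ellipsePoint (hS : radius S < t) (e : Circle) : unitDir (ellipsePoint t S e) = e :=
  unitDir_smul_circle (ellipseRadius_pos hS e) e

lemma eq_ellipsePoint_of_mem {X : Hyp} (hS : radius S < t) (hX : X ∈ beachEllipse t S) :
    X = ellipsePoint t S (unitDir X) := by
  rw [← radius_smul_unitDir X, smul_circle_mem_beachEllipse_iff hS (radius_nonneg X)] at hX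
  rw [ellipsePoint, ← hX, radius_smul_unitDir]

lemma radius_eq_ellipseRadius_of_mem {X : Hyp} (hS : radius S < t) (hX : X ∈ beachEllipse t S) :
    radius X = ellipseRadius t S (unitDir X) :=
  (congrArg radius (eq_ellipsePoint_of_mem hS hX)).trans (radius_ellipsePoint hS _)

lemma continuousAt_artanh {x : ℝ} (hx : x ∈ Set.Ioo (-1) 1) : ContinuousAt Real.artanh x := by
  have hnum : 0 < 1 + x := by linarith [hx.1]
  have hden : 0 < 1 - x := sub_pos.2 hx.2
  have hdiv : ContinuousAt (fun y : ℝ => (1 + y) / (1 - y)) x :=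
    (continuousAt_const.add continuousAt_id).div (continuousAt_const.sub continuousAt_id) hden.ne'
  exact hdiv.sqrt.log (Real.sqrt_pos.2 (div_pos hnum hden)).ne'

lemma continuousAt_ellipsePoint (hS : radius S < t) (e : Circle) :
    ContinuousAt (fun p : ℝ × Circle => ellipsePoint p.1 S p.2) (t, e) := by
  obtain ⟨hpos, hlt⟩ := ellipseRatio_mem_Ioo hS e
  have hratio : ContinuousAt (fun p : ℝ × Circle => ellipseRatio p.1 S p.2) (t, e) := by
    refine ContinuousAt.div ?_ ?_ (sinh_sub_inner_pos hS e).ne' <;> fun_prop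
  exact ((continuousAt_artanh ⟨neg_one_lt_zero.trans hpos, hlt⟩).comp_of_eq hratio rfl).smul
    (by fun_prop)

end Ellipse

/-! ### Affine functions on the unit circle -/

section Affine

variable {B : ℂ} {c x y : ℝ} {e : Circle}

lemma inner_exp_mul (B : ℂ) (x : ℝ) (e : Circle) :
    ⟪B, (Circle.exp x * e : Circle)⟫ =
      ⟪B, e⟫ * Real.cos x + ⟪B, Complex.I * e⟫ * Real.sin x := by
  simp only [real_inner_eq_add, Circle.coe_mul, Circle.coe_exp, Complex.mul_re, Complex.mul_im,
    Complex.exp_ofReal_mul_I_re, Complex.exp_ofReal_mul_I_im, Complex.I_re, Complex.I_im]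
  ring

lemma add_inner_exp_mul_of_root (h : c + ⟪B, e⟫ = 0) (x : ℝ) :
    c + ⟪B, (Circle.exp x * e : Circle)⟫ = 2 * Real.sin (x / 2) *
      (c * Real.sin (x / 2) + ⟪B, Complex.I * e⟫ * Real.cos (x / 2)) := by
  obtain ⟨y, rfl⟩ : ∃ y, x = 2 * y := ⟨x / 2, by ring⟩
  rw [inner_exp_mul, mul_div_cancel_left₀ y two_ne_zero, Real.sin_two_mul, Real.cos_two_mul']
  linear_combination (Real.cos y ^ 2 - Real.sin y ^ 2) * h - c * Real.sin_sq_add_cos_sq y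

lemma inner_I_mul_sq_of_root (h : c + ⟪B, e⟫ = 0) :
    ⟪B, Complex.I * e⟫ ^ 2 = ‖B‖ ^ 2 - c ^ 2 := by
  linear_combination inner_sq_add_inner_I_mul_sq e B + (c - ⟪B, e⟫) * h

lemma inner_I_mul_eq_zero_of_isLocalMax
    (h : IsLocalMax (fun x : ℝ => c + ⟪B, (Circle.exp x * e : Circle)⟫) 0) :
    ⟪B, Complex.I * e⟫ = 0 := by
  simp only [inner_exp_mul] at h
  have hderiv := (((Real.hasDerivAt_cos 0).const_mul ⟪B, (e : ℂ)⟫).add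
    ((Real.hasDerivAt_sin 0).const_mul ⟪B, Complex.I * e⟫)).const_add c
  simpa only [Real.sin_zero, Real.cos_zero, neg_zero, mul_zero, zero_add, mul_one] using
    h.hasDerivAt_eq_zero hderiv

lemma sin_half_mul_add_neg {s : ℝ} (hs : s ≤ 0) (hx : 0 < x) (hxy : x ≤ y)
    (hy : y < 2 * Real.pi)
    (hneg : 2 * Real.sin (y / 2) * (c * Real.sin (y / 2) + s * Real.cos (y / 2)) < 0) :
    2 * Real.sin (x / 2) * (c * Real.sin (x / 2) + s * Real.cos (x / 2)) < 0 := by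
  have hsinx : 0 < Real.sin (x / 2) := Real.sin_pos_of_pos_of_lt_pi (by linarith) (by linarith)
  have hsiny : 0 < Real.sin (y / 2) := Real.sin_pos_of_pos_of_lt_pi (by linarith) (by linarith)
  have hsub : 0 ≤ Real.sin (y / 2 - x / 2) :=
    Real.sin_nonneg_of_nonneg_of_le_pi (by linarith) (by linarith)
  have hneg' : c * Real.sin (y / 2) + s * Real.cos (y / 2) < 0 :=
    (pos_iff_neg_of_mul_neg hneg).1 (by positivity)
  have hcombine : Real.sin (y / 2) * (c * Real.sin (x / 2) + s * Real.cos (x / 2)) =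
      Real.sin (x / 2) * (c * Real.sin (y / 2) + s * Real.cos (y / 2)) +
        s * Real.sin (y / 2 - x / 2) := by
    rw [Real.sin_sub]
    ring
  have hprod := add_neg_of_neg_of_nonpos (mul_neg_of_pos_of_neg hsinx hneg')
    (mul_nonpos_of_nonpos_of_nonneg hs hsub)
  rw [← hcombine] at hprod
  exact mul_neg_of_pos_of_neg (by positivity) ((pos_iff_neg_of_mul_neg hprod).1 hsiny)

lemma add_inner_exp_mul_neg (h : c + ⟪B, e⟫ = 0) (hs : ⟪B, Complex.I * e⟫ ≤ 0) (hx : 0 < x)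
    (hxy : x ≤ y) (hy : y < 2 * Real.pi) (hneg : c + ⟪B, (Circle.exp y * e : Circle)⟫ < 0) :
    c + ⟪B, (Circle.exp x * e : Circle)⟫ < 0 := by
  rw [add_inner_exp_mul_of_root h] at hneg ⊢
  exact sin_half_mul_add_neg hs hx hxy hy hneg

lemma add_inner_exp_neg_mul_neg (h : c + ⟪B, e⟫ = 0) (hs : 0 ≤ ⟪B, Complex.I * e⟫) (hx : 0 < x)
    (hxy : x ≤ y) (hy : y < 2 * Real.pi) (hneg : c + ⟪B, (Circle.exp (-y) * e : Circle)⟫ < 0) :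
    c + ⟪B, (Circle.exp (-x) * e : Circle)⟫ < 0 := by
  have hreflect : ∀ z : ℝ, c + ⟪B, (Circle.exp (-z) * e : Circle)⟫ = 2 * Real.sin (z / 2) *
      (c * Real.sin (z / 2) + -⟪B, Complex.I * e⟫ * Real.cos (z / 2)) := by
    intro z
    rw [add_inner_exp_mul_of_root h, neg_div, Real.sin_neg, Real.cos_neg]
    ring
  rw [hreflect] at hneg ⊢
  exact sin_half_mul_add_neg (neg_nonpos.2 hs) hx hxy hy hneg

end Affine

/-- The root of `e ↦ c + ⟪B, e⟫` on the unit circle at which the derivative `⟪B, I * e⟫` in the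
counterclockwise direction is `s`; it exists if and only if `c ^ 2 + s ^ 2 = ‖B‖ ^ 2`. -/
noncomputable def circleRoot (c s : ℝ) (B : ℂ) : Circle := unitDir (B * ⟨-c, -s⟩)

section CircleRoot

variable {B : ℂ} {c s : ℝ} {e : Circle}

lemma norm_mk_neg_neg (h : c ^ 2 + s ^ 2 = ‖B‖ ^ 2) : ‖(⟨-c, -s⟩ : ℂ)‖ = ‖B‖ := by
  refine (sq_eq_sq₀ (norm_nonneg _) (norm_nonneg _)).1 ?_
  rw [← h, Complex.sq_norm, Complex.normSq_mk]
  ring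

lemma eq_circleRoot_iff (hB : B ≠ 0) (h : c ^ 2 + s ^ 2 = ‖B‖ ^ 2) :
    e = circleRoot c s B ↔ c + ⟪B, e⟫ = 0 ∧ ⟪B, Complex.I * e⟫ = s := by
  have hpos : 0 < ‖B‖ ^ 2 := by positivity
  have hnorm : ‖B * ⟨-c, -s⟩‖ = ‖B‖ ^ 2 := by rw [norm_mul, norm_mk_neg_neg h, sq]
  have hne : B * ⟨-c, -s⟩ ≠ 0 := norm_pos_iff.1 (hnorm.symm ▸ hpos)
  have hconj : e = circleRoot c s B ↔ starRingEnd ℂ B * e = ⟨-c, -s⟩ := by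
    rw [← Circle.coe_inj, circleRoot, coe_unitDir hne, radius, hnorm,
      eq_div_iff (Complex.ofReal_ne_zero.2 hpos.ne'), Complex.ofReal_pow, ← Complex.mul_conj',
      mul_comm, mul_assoc, mul_right_inj' hB]
  rw [hconj, Complex.ext_iff]
  simp only [real_inner_eq_add, Complex.mul_re, Complex.mul_im, Complex.conj_re, Complex.conj_im,
    Complex.I_re, Complex.I_im]
  constructor <;> rintro ⟨hre, him⟩ <;> constructor <;> linarith

lemma continuousOn_circleRoot {α : Type*} [TopologicalSpace α] {c s : α → ℝ} {B : α → ℂ}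
    {K : Set α} (hc : ContinuousOn c K) (hs : ContinuousOn s K) (hB : ContinuousOn B K)
    (hB₀ : ∀ t ∈ K, B t ≠ 0) (h : ∀ t ∈ K, c t ^ 2 + s t ^ 2 = ‖B t‖ ^ 2) :
    ContinuousOn (fun t => circleRoot (c t) (s t) (B t)) K := by
  have hmk : ContinuousOn (fun t => (⟨-c t, -s t⟩ : ℂ)) K :=
    Complex.equivRealProdCLM.symm.continuous.comp_continuousOn (hc.neg.prodMk hs.neg)
  intro t ht
  have hne : B t * ⟨-c t, -s t⟩ ≠ 0 :=
    mul_ne_zero (hB₀ t ht) (norm_pos_iff.1 ((norm_mk_neg_neg (h t ht)).symm ▸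
      norm_pos_iff.2 (hB₀ t ht)))
  exact (continuousAt_unitDir hne).comp_continuousWithinAt (f := fun t => B t * ⟨-c t, -s t⟩)
    (hB.mul hmk t ht)

end CircleRoot

lemma sign_sin {x : ℝ} (hx : |x| < Real.pi) :
    SignType.sign (Real.sin x) = SignType.sign x := by
  obtain ⟨hlt, hgt⟩ := abs_lt.1 hx
  rcases lt_trichotomy x 0 with hneg | rfl | hpos
  · rw [sign_neg hneg, sign_neg (Real.sin_neg_of_neg_of_neg_pi_lt hneg hlt)]
  · rw [Real.sin_zero]
  · rw [sign_pos hpos, sign_pos (Real.sin_pos_of_pos_of_lt_pi hpos hgt)]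

lemma eventually_sign_add_inner_exp_mul {α : Type*} {l : Filter α} {c θ : α → ℝ} {B : α → ℂ}
    {e : α → Circle} {c₀ σ : ℝ} (hθ : Tendsto θ l (𝓝 0)) (hc : Tendsto c l (𝓝 c₀))
    (hσ : Tendsto (fun t => ⟪B t, Complex.I * e t⟫) l (𝓝 σ)) (hσ₀ : σ ≠ 0)
    (hroot : ∀ᶠ t in l, c t + ⟪B t, e t⟫ = 0) :
    ∀ᶠ t in l, SignType.sign (c t + ⟪B t, (Circle.exp (θ t) * e t : Circle)⟫) =
      SignType.sign (θ t) * SignType.sign σ := by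
  have hhalf : Tendsto (fun t => θ t / 2) l (𝓝 0) := by simpa only [zero_div] using hθ.div_const 2
  have hfactor : Tendsto (fun t => c t * Real.sin (θ t / 2) +
      ⟪B t, Complex.I * e t⟫ * Real.cos (θ t / 2)) l (𝓝 σ) := by
    have hlim := (hc.mul ((Real.continuous_sin.tendsto 0).comp hhalf)).add
      (hσ.mul ((Real.continuous_cos.tendsto 0).comp hhalf))
    rwa [Real.sin_zero, Real.cos_zero, mul_zero, zero_add, mul_one] at hlim
  have hsmall : ∀ᶠ t in l, |θ t / 2| < Real.pi :=
    hhalf.abs.eventually_lt_const (abs_zero.trans_lt Real.pi_pos)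
  have hsign : ∀ᶠ y in 𝓝 σ, SignType.sign σ = SignType.sign y :=
    (continuousAt_sign_of_ne_zero hσ₀).eventually (mem_nhds_discrete.2 rfl)
  filter_upwards [hroot, hsmall, hfactor.eventually hsign] with t ht hlt hsign
  rw [add_inner_exp_mul_of_root ht, sign_mul, ← hsign, sign_mul, sign_sin hlt, sign_pos two_pos,
    one_mul, div_eq_mul_inv, sign_mul, sign_pos (inv_pos.2 two_pos), mul_one]

/-! ### Comparison of two beach ellipses -/

/-- The constant term of `gap`. -/
noncomputable def gapConst (S T : Hyp) (t : ℝ) : ℝ := Real.sinh t * (timeCoord S - timeCoord T)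

/-- The linear coefficient of `gap`. -/
noncomputable def gapVec (S T : Hyp) (t : ℝ) : ℂ :=
  (Real.cosh t - timeCoord S) • spaceCoord T - (Real.cosh t - timeCoord T) • spaceCoord S

/-- The comparison function of the beach ellipses of `S` and `T`: it is negative in the directions
in which the one of `S` is further out, and zero in those in which they meet. In terms of the
direction it is an affine function on the unit circle. -/
noncomputable def gap (S T : Hyp) (t : ℝ) (e : Circle) : ℝ := gapConst S T t + ⟪gapVec S T t, e⟫

/-- The square of the derivative of `gap` at its zeros. -/
noncomputable def gapDisc (S T : Hyp) (t : ℝ) : ℝ :=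
  2 * (Real.cosh (hdist S T) - 1) * (Real.cosh t - timeCoord S) * (Real.cosh t - timeCoord T)

section Gap

variable {S T : Hyp} {t : ℝ} {e : Circle}

lemma inner_gapVec (S T : Hyp) (t : ℝ) (w : ℂ) : ⟪gapVec S T t, w⟫ =
    (Real.cosh t - timeCoord S) * ⟪spaceCoord T, w⟫ -
      (Real.cosh t - timeCoord T) * ⟪spaceCoord S, w⟫ := by
  rw [gapVec, inner_sub_left, real_inner_smul_left, real_inner_smul_left]

lemma gap_eq (S T : Hyp) (t : ℝ) (e : Circle) : gap S T t e =
    (Real.sinh t - ⟪spaceCoord S, e⟫) * (Real.cosh t - timeCoord T) -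
      (Real.sinh t - ⟪spaceCoord T, e⟫) * (Real.cosh t - timeCoord S) := by
  rw [gap, inner_gapVec, gapConst]
  ring

lemma norm_gapVec_sq (S T : Hyp) (t : ℝ) :
    ‖gapVec S T t‖ ^ 2 = gapConst S T t ^ 2 + gapDisc S T t := by
  rw [gapVec, norm_sub_sq_real, norm_smul, norm_smul, real_inner_smul_left, real_inner_smul_right,
    Real.norm_eq_abs, Real.norm_eq_abs, mul_pow, mul_pow, sq_abs, sq_abs, gapConst, gapDisc,
    cosh_hdist, real_inner_comm]
  linear_combination (timeCoord S - timeCoord T) ^ 2 * Real.cosh_sq t -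
    (Real.cosh t - timeCoord S) ^ 2 * timeCoord_sq T -
    (Real.cosh t - timeCoord T) ^ 2 * timeCoord_sq S

lemma inner_gapVec_I_mul_sq (h : gap S T t e = 0) :
    ⟪gapVec S T t, Complex.I * e⟫ ^ 2 = gapDisc S T t := by
  rw [inner_I_mul_sq_of_root h, norm_gapVec_sq, add_sub_cancel_left]

lemma cosh_sub_timeCoord_nonneg (hS : radius S ≤ t) : 0 ≤ Real.cosh t - timeCoord S :=
  sub_nonneg.2 (Real.cosh_strictMonoOn.monotoneOn (radius_nonneg S)
    ((radius_nonneg S).trans hS) hS)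

lemma timeCoord_eq_cosh (hT : radius T = t) : timeCoord T = Real.cosh t := by
  rw [timeCoord, hT]

lemma gapDisc_nonneg (hS : radius S ≤ t) (hT : radius T ≤ t) : 0 ≤ gapDisc S T t :=
  mul_nonneg (mul_nonneg (mul_nonneg zero_le_two (sub_nonneg.2 (Real.one_le_cosh _)))
    (cosh_sub_timeCoord_nonneg hS)) (cosh_sub_timeCoord_nonneg hT)

lemma gapDisc_pos (hST : S ≠ T) (hS : radius S < t) (hT : radius T < t) : 0 < gapDisc S T t :=
  mul_pos (mul_pos (mul_pos two_pos (sub_pos.2 (Real.one_lt_cosh.2 (hdist_pos hST).ne')))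
    (cosh_sub_timeCoord_pos hS)) (cosh_sub_timeCoord_pos hT)

lemma gapVec_ne_zero (hST : S ≠ T) (hS : radius S < t) (hT : radius T ≤ t) :
    gapVec S T t ≠ 0 := by
  intro h
  have hnorm := norm_gapVec_sq S T t
  rw [h, norm_zero, zero_pow two_ne_zero] at hnorm
  rcases hT.lt_or_eq with hlt | heq
  · linarith [gapDisc_pos hST hS hlt, sq_nonneg (gapConst S T t)]
  · have hconst : gapConst S T t = 0 := by
      refine sq_eq_zero_iff.1 (le_antisymm ?_ (sq_nonneg _))
      linarith [gapDisc_nonneg hS.le hT]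
    rw [gapConst, timeCoord_eq_cosh heq, mul_eq_zero, sub_eq_zero] at hconst
    exact hconst.elim (Real.sinh_pos_iff.2 ((radius_nonneg S).trans_lt hS)).ne'
      (timeCoord_lt_cosh hS).ne

lemma gap_self (S : Hyp) (t : ℝ) (e : Circle) : gap S S t e = 0 := by
  rw [gap_eq, sub_self]

lemma gap_of_radius_eq (hT : radius T = t) (e : Circle) :
    gap S T t e = (Real.cosh t - timeCoord S) * (⟪spaceCoord T, e⟫ - Real.sinh t) := by
  rw [gap_eq, timeCoord_eq_cosh hT]
  ring

lemma gap_nonpos_of_radius_eq (hS : radius S ≤ t) (hT : radius T = t) (e : Circle) :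
    gap S T t e ≤ 0 := by
  rw [gap_of_radius_eq hT, ← hT]
  exact mul_nonpos_of_nonneg_of_nonpos (hT ▸ cosh_sub_timeCoord_nonneg hS)
    (sub_nonpos.2 (inner_spaceCoord_le_sinh T e))

lemma gap_eq_zero_iff_of_radius_eq (hS : radius S < t) (hT : radius T = t) :
    gap S T t e = 0 ↔ unitDir T = e := by
  have hsinh : 0 < Real.sinh t := Real.sinh_pos_iff.2 ((radius_nonneg S).trans_lt hS)
  rw [gap_of_radius_eq hT, mul_eq_zero, or_iff_right (cosh_sub_timeCoord_pos hS).ne', spaceCoord,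
    real_inner_smul_left, hT, sub_eq_zero, mul_eq_left₀ hsinh.ne', inner_circle_eq_one_iff]

lemma ellipseRadius_lt_iff (hS : radius S < t) (hT : radius T < t) (e : Circle) :
    ellipseRadius t T e < ellipseRadius t S e ↔ gap S T t e < 0 := by
  have hIoo : Set.Ioo (0 : ℝ) 1 ⊆ Set.Ioo (-1) 1 := Set.Ioo_subset_Ioo_left (by norm_num)
  rw [ellipseRadius, ellipseRadius, Real.artanh_lt_artanh_iff (hIoo (ellipseRatio_mem_Ioo hT e))
    (hIoo (ellipseRatio_mem_Ioo hS e)), ellipseRatio, ellipseRatio,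
    div_lt_div_iff₀ (sinh_sub_inner_pos hT e) (sinh_sub_inner_pos hS e), gap_eq, sub_neg,
    mul_comm (Real.sinh t - ⟪spaceCoord S, (e : ℂ)⟫),
    mul_comm (Real.sinh t - ⟪spaceCoord T, (e : ℂ)⟫)]

lemma gap_mul_sinh (hS : radius S < t) (T : Hyp) (e : Circle) :
    gap S T t e * Real.sinh (ellipseRadius t S e) = (Real.cosh t - timeCoord S) *
      (Real.cosh (t - ellipseRadius t S e) - Real.cosh (hdist (ellipsePoint t S e) T)) := by
  have hdistance := cosh_hdist_smul_circle_sub_cosh (ellipseRadius_pos hS e).le e T t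
  have hellipse := (eq_ellipseRadius_iff hS e).1 rfl
  rw [ellipsePoint, gap_eq]
  linear_combination (Real.cosh t - timeCoord S) * hdistance +
    (Real.cosh t - timeCoord T) * hellipse

lemma ellipseRadius_le (hS : radius S < t) (e : Circle) : ellipseRadius t S e ≤ t := by
  have hmem : hdist _ S = t - _ := ellipsePoint_mem_beachEllipse hS e
  rw [radius_ellipsePoint hS] at hmem
  exact sub_nonneg.1 (hmem ▸ hdist_nonneg _ _)

lemma sign_cosh_sub_cosh {x y : ℝ} (hx : 0 ≤ x) (hy : 0 ≤ y) :
    SignType.sign (Real.cosh x - Real.cosh y) = SignType.sign (x - y) := by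
  rcases lt_trichotomy x y with h | rfl | h
  · rw [sign_neg (sub_neg.2 h), sign_neg (sub_neg.2 (Real.cosh_strictMonoOn hx hy h))]
  · rw [sub_self, sub_self]
  · rw [sign_pos (sub_pos.2 h), sign_pos (sub_pos.2 (Real.cosh_strictMonoOn hy hx h))]

lemma sign_gap (hS : radius S < t) (T : Hyp) (e : Circle) : SignType.sign (gap S T t e) =
    SignType.sign (t - ellipseRadius t S e - hdist (ellipsePoint t S e) T) := by
  have hsinh : 0 < Real.sinh (ellipseRadius t S e) :=
    Real.sinh_pos_iff.2 (ellipseRadius_pos hS e)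
  have hsign := congrArg SignType.sign (gap_mul_sinh hS T e)
  rw [sign_mul, sign_pos hsinh, mul_one, sign_mul, sign_pos (cosh_sub_timeCoord_pos hS),
    one_mul] at hsign
  rw [hsign, sign_cosh_sub_cosh (sub_nonneg.2 (ellipseRadius_le hS e)) (hdist_nonneg _ _)]

lemma gap_neg_iff (hS : radius S < t) : gap S T t e < 0 ↔
    t - ellipseRadius t S e < hdist (ellipsePoint t S e) T := by
  rw [← sign_eq_neg_one_iff, sign_gap hS, sign_eq_neg_one_iff, sub_neg]

lemma gap_pos_iff (hS : radius S < t) : 0 < gap S T t e ↔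
    hdist (ellipsePoint t S e) T < t - ellipseRadius t S e := by
  rw [← sign_eq_one_iff, sign_gap hS, sign_eq_one_iff, sub_pos]

lemma gap_eq_zero_iff (hS : radius S < t) :
    gap S T t e = 0 ↔ ellipsePoint t S e ∈ beachEllipse t T := by
  rw [← sign_eq_zero_iff, sign_gap hS, sign_eq_zero_iff, sub_eq_zero, eq_comm, beachEllipse,
    Set.mem_ofPred_eq, radius_ellipsePoint hS]

/-- A site that has just been reached by the sweep circle is on the beach curve. -/
lemma gap_unitDir_pos (hST : radius S < radius T) (hT : radius T < t) :
    0 < gap S T t (unitDir T) := by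
  have hS := hST.trans hT
  have hellipse : hdist _ S = t - _ := ellipsePoint_mem_beachEllipse hS (unitDir T)
  have htri := abs_radius_sub_le_hdist (ellipsePoint t S (unitDir T)) S
  have hdist_eq := hdist_smul_circle (ellipseRadius_pos hS (unitDir T)).le (radius_nonneg T)
    (unitDir T)
  rw [radius_smul_unitDir] at hdist_eq
  rw [hellipse, radius_ellipsePoint hS] at htri
  rw [gap_pos_iff hS, ellipsePoint, hdist_eq, abs_lt]
  constructor <;> linarith [le_abs_self (ellipseRadius t S (unitDir T) - radius S)]

lemma continuous_gapConst (S T : Hyp) : Continuous (gapConst S T) :=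
  Real.continuous_sinh.mul continuous_const

lemma continuous_gapVec (S T : Hyp) : Continuous (gapVec S T) := by
  unfold gapVec
  fun_prop

lemma continuous_gapDisc (S T : Hyp) : Continuous (gapDisc S T) := by
  unfold gapDisc
  fun_prop

lemma continuous_gap (S T : Hyp) : Continuous fun p : ℝ × Circle => gap S T p.1 p.2 :=
  ((continuous_gapConst S T).comp continuous_fst).add
    (((continuous_gapVec S T).comp continuous_fst).inner
      (continuous_subtype_val.comp continuous_snd))

/-- The direction of one of the two points where the beach ellipses of `S` and `T` meet: the one
at which `gap S T t` has a derivative with the sign of `ε = ±1`. -/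
noncomputable def meetDir (S T : Hyp) (ε t : ℝ) : Circle :=
  circleRoot (gapConst S T t) (ε * √(gapDisc S T t)) (gapVec S T t)

lemma gapConst_sq_add_sq {ε : ℝ} (hε : ε ^ 2 = 1) (hS : radius S ≤ t) (hT : radius T ≤ t) :
    gapConst S T t ^ 2 + (ε * √(gapDisc S T t)) ^ 2 = ‖gapVec S T t‖ ^ 2 := by
  rw [mul_pow, hε, one_mul, Real.sq_sqrt (gapDisc_nonneg hS hT), norm_gapVec_sq]

lemma eq_meetDir_iff {ε : ℝ} (hε : ε ^ 2 = 1) (hST : S ≠ T) (hS : radius S < t)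
    (hT : radius T ≤ t) : e = meetDir S T ε t ↔
      gap S T t e = 0 ∧ ⟪gapVec S T t, Complex.I * e⟫ = ε * √(gapDisc S T t) :=
  eq_circleRoot_iff (gapVec_ne_zero hST hS hT) (gapConst_sq_add_sq hε hS.le hT)

lemma continuousOn_meetDir {ε : ℝ} {K : Set ℝ} (hε : ε ^ 2 = 1) (hST : S ≠ T)
    (hS : ∀ t ∈ K, radius S < t) (hT : ∀ t ∈ K, radius T ≤ t) :
    ContinuousOn (meetDir S T ε) K :=
  continuousOn_circleRoot (continuous_gapConst S T).continuousOn
    (continuous_const.mul (continuous_gapDisc S T).sqrt).continuousOn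
    (continuous_gapVec S T).continuousOn (fun t ht => gapVec_ne_zero hST (hS t ht) (hT t ht))
    fun t ht => gapConst_sq_add_sq hε (hS t ht).le (hT t ht)

end Gap

/-! ### Points of the beach curve -/

section BeachCurve

variable {𝒮 : Finset Hyp} {S T X : Hyp} {t : ℝ} {e : Circle}

lemma gap_swap (S T : Hyp) (t : ℝ) (e : Circle) : gap T S t e = -gap S T t e := by
  rw [gap_eq, gap_eq, neg_sub]

lemma ellipseRadius_le_iff (hS : radius S < t) (hT : radius T < t) (e : Circle) :
    ellipseRadius t T e ≤ ellipseRadius t S e ↔ gap S T t e ≤ 0 := by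
  rw [← not_lt, ellipseRadius_lt_iff hT hS, gap_swap, neg_lt_zero, not_lt]

lemma unitDir_eq_of_mem_beachEllipse (ht : 0 < t) (hT : radius T = t) (hX : X ∈ beachEllipse t T)
    (hX₀ : X ≠ 0) : unitDir T = unitDir X := by
  have hdist_eq : hdist X T = t - radius X := hX
  have hnonneg := hdist_nonneg X T
  refine (unitDir_eq_of_hdist_eq hX₀ (radius_pos.1 (hT ▸ ht)) ?_).symm
  rw [hT, abs_sub_comm, abs_of_nonneg (hdist_eq ▸ hnonneg), hdist_eq]

lemma radius_le_of_gap_nonpos (hS : radius S < t) (hT : radius T ≤ t)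
    (hgap : gap S T t (unitDir X) ≤ 0) (hX : X ∈ beachEllipse t T)
    (hne : radius T = t → unitDir T ≠ unitDir X) : radius X ≤ ellipseRadius t S (unitDir X) := by
  rcases hT.lt_or_eq with hlt | heq
  · rwa [radius_eq_ellipseRadius_of_mem hlt hX, ellipseRadius_le_iff hS hlt]
  · have hX₀ : X = 0 := by
      by_contra hX₀
      exact hne heq
        (unitDir_eq_of_mem_beachEllipse ((radius_nonneg S).trans_lt hS) heq hX hX₀)
    rw [show radius X = 0 from norm_eq_zero.2 hX₀]
    exact (ellipseRadius_pos hS _).le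

lemma radius_lt_of_gap_neg (hS : radius S < t) (hT : radius T ≤ t)
    (hgap : gap S T t (unitDir X) < 0) (hX : X ∈ beachEllipse t T) :
    radius X < ellipseRadius t S (unitDir X) := by
  refine (radius_le_of_gap_nonpos hS hT hgap.le hX fun heq hdir =>
    hgap.ne ((gap_eq_zero_iff_of_radius_eq hS heq).2 hdir)).lt_of_ne fun heq => hgap.ne ?_
  rwa [gap_eq_zero_iff hS, ellipsePoint, ← heq, radius_smul_unitDir]

lemma mem_activePart_of_gap_nonpos (hS : radius S < t)
    (hgap : ∀ U ∈ 𝒮, radius U ≤ t → gap S U t e ≤ 0)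
    (hT : ellipsePoint t S e ∈ beachEllipse t T)
    (hunique : ∀ U ∈ 𝒮, radius U = t → unitDir U = e → U = T) :
    ellipsePoint t S e ∈ activePart 𝒮 t T := by
  refine ⟨hT, ?_⟩
  rintro ⟨U, ⟨hU, hUt⟩, hUT, X, hX, hangle, hlt⟩
  have hdir : unitDir X = e := by
    rw [← unitDir_eq_unitDir_iff.2 hangle, unitDir_ellipsePoint hS]
  have hle := radius_le_of_gap_nonpos hS hUt (hdir ▸ hgap U hU hUt) hX
    fun heq hUX => hUT (hunique U hU heq (hUX.trans hdir))
  rw [hdir, ← radius_ellipsePoint hS] at hle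
  exact hle.not_gt hlt

lemma ellipsePoint_mem_beachCurve (hS₀ : S ∈ 𝒮) (hS : radius S < t)
    (hgap : ∀ U ∈ 𝒮, radius U ≤ t → gap S U t e ≤ 0) : ellipsePoint t S e ∈ beachCurve 𝒮 t := by
  by_cases hsweep : ∃ T ∈ 𝒮, radius T = t ∧ unitDir T = e
  · obtain ⟨T, hT₀, hT, hTe⟩ := hsweep
    refine Set.mem_biUnion (show T ∈ seenSites 𝒮 t from ⟨hT₀, hT.le⟩) ?_
    refine mem_activePart_of_gap_nonpos hS hgap
      ((gap_eq_zero_iff hS).1 ((gap_eq_zero_iff_of_radius_eq hS hT).2 hTe)) fun U _ hU hUe => ?_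
    rw [← radius_smul_unitDir U, ← radius_smul_unitDir T, hU, hT, hUe, hTe]
  · refine Set.mem_biUnion (show S ∈ seenSites 𝒮 t from ⟨hS₀, hS.le⟩) ?_
    exact mem_activePart_of_gap_nonpos hS hgap (ellipsePoint_mem_beachEllipse hS e)
      fun U hU₀ hU hUe => absurd ⟨U, hU₀, hU, hUe⟩ hsweep

lemma mem_activePart_of_gap_neg (hS₀ : S ∈ 𝒮) (hS : radius S < t)
    (hgap : ∀ U ∈ 𝒮, radius U ≤ t → U ≠ S → gap S U t (unitDir X) < 0)
    (hX : X ∈ beachCurve 𝒮 t) : X ∈ activePart 𝒮 t S := by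
  obtain ⟨T, ⟨hT₀, hT⟩, hXT, hactive⟩ := Set.mem_iUnion₂.1 hX
  by_cases hTS : T = S
  · exact hTS ▸ ⟨hXT, hactive⟩
  · refine absurd ⟨S, ⟨hS₀, hS.le⟩, Ne.symm hTS, _, ellipsePoint_mem_beachEllipse hS (unitDir X),
      ?_, ?_⟩ hactive
    · exact unitDir_eq_unitDir_iff.1 (unitDir_ellipsePoint hS _).symm
    · rw [radius_ellipsePoint hS]
      exact radius_lt_of_gap_neg hS hT (hgap T hT₀ hT hTS) hXT

lemma notMem_beachIntersections_of_gap_neg (hS₀ : S ∈ 𝒮) (hS : radius S < t)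
    (hgap : ∀ U ∈ 𝒮, radius U ≤ t → U ≠ S → gap S U t (unitDir X) < 0) :
    X ∉ beachIntersections 𝒮 t := by
  rintro ⟨hX, A, hA, B, hB, hAB, hXA, hXB⟩
  have hXS := (mem_activePart_of_gap_neg hS₀ hS hgap hX).1
  have honly : ∀ T ∈ seenSites 𝒮 t, X ∈ beachEllipse t T → T = S := by
    intro T hT hXT
    by_contra hTS
    exact (radius_lt_of_gap_neg hS hT.2 (hgap T hT.1 hT.2 hTS) hXT).ne
      (radius_eq_ellipseRadius_of_mem hS hXS)
  exact hAB ((honly A hA hXA).trans (honly B hB hXB).symm)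

end BeachCurve

/-! ### Arcs -/

section Arcs

variable {e f g : Circle} {x y : ℝ}

lemma angleDiff_eq_of_exp_mul (h₀ : 0 ≤ x) (h₁ : x < 2 * Real.pi) (h : Circle.exp x * e = f) :
    Circle.angleDiff e f = x := by
  refine Circle.exp_injOn_Ico (a := 0) (b := 2 * Real.pi) (by rw [sub_zero])
    ⟨Circle.angleDiff_nonneg e f, Circle.angleDiff_lt_two_pi e f⟩ ⟨h₀, h₁⟩ ?_
  rw [← mul_left_inj e, Circle.exp_angleDiff_mul, h]

lemma angleDiff_self (e : Circle) : Circle.angleDiff e e = 0 :=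
  angleDiff_eq_of_exp_mul le_rfl Real.two_pi_pos (by rw [Circle.exp_zero, one_mul])

lemma ccw_eq_angleDiff (P Q : Hyp) : ccw P Q = Circle.angleDiff (unitDir P) (unitDir Q) := by
  obtain ⟨h₀, h₁⟩ := mod2pi_mem_Ico (angle Q - angle P)
  refine (angleDiff_eq_of_exp_mul h₀ h₁ ?_).symm
  rw [exp_mod2pi, unitDir, unitDir, ← Circle.exp_add, sub_add_cancel]

lemma neg_coe_mem_slitPlane (h : e ≠ 1) : -(e : ℂ) ∈ Complex.slitPlane := by
  rw [Complex.mem_slitPlane_iff]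
  by_contra! hcon
  rw [Complex.neg_re, Complex.neg_im, neg_nonpos, neg_eq_zero] at hcon
  have hsq := re_sq_add_im_sq e
  rw [hcon.2, zero_pow two_ne_zero, add_zero] at hsq
  refine h (Circle.ext (Complex.ext ?_ ?_))
  · rw [Circle.coe_one, Complex.one_re]
    exact (pow_eq_one_iff_of_nonneg hcon.1 two_ne_zero).1 hsq
  · rw [Circle.coe_one, Complex.one_im]
    exact hcon.2

lemma angleDiff_eq_pi_add_arg (h : e ≠ f) :
    Circle.angleDiff e f = Real.pi + Complex.arg (-((f / e : Circle) : ℂ)) := by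
  have hslit : -((f / e : Circle) : ℂ) ∈ Complex.slitPlane :=
    neg_coe_mem_slitPlane (div_ne_one.2 h.symm)
  have hlt := (Complex.arg_le_pi _).lt_of_ne (Complex.mem_slitPlane_iff_arg.1 hslit).1
  have hgt := Complex.neg_pi_lt_arg (-((f / e : Circle) : ℂ))
  refine angleDiff_eq_of_exp_mul (by linarith) (by linarith) ?_
  have hpolar := Complex.norm_mul_exp_arg_mul_I (-((f / e : Circle) : ℂ))
  rw [norm_neg, Circle.norm_coe, Complex.ofReal_one, one_mul] at hpolar
  have hexp : Circle.exp (Real.pi + Complex.arg (-((f / e : Circle) : ℂ))) = f / e := by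
    refine Circle.coe_injective ?_
    rw [Circle.coe_exp, Complex.ofReal_add, add_mul, Complex.exp_add, hpolar, Complex.exp_pi_mul_I,
      neg_one_mul, neg_neg]
  rw [hexp, div_mul_cancel]

lemma continuousAt_angleDiff (h : e ≠ f) :
    ContinuousAt (fun p : Circle × Circle => Circle.angleDiff p.1 p.2) (e, f) := by
  have hdiv : Continuous fun p : Circle × Circle => p.2 / p.1 :=
    continuous_snd.div' continuous_fst
  have harg := (Complex.continuousAt_arg (neg_coe_mem_slitPlane (div_ne_one.2 h.symm))).comp
    (f := fun p : Circle × Circle => -((p.2 / p.1 : Circle) : ℂ)) (x := (e, f))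
    (continuous_subtype_val.comp hdiv).neg.continuousAt
  refine (harg.const_add Real.pi).congr ?_
  filter_upwards [(isOpen_ne_fun continuous_fst continuous_snd).mem_nhds h] with p hp
  exact (angleDiff_eq_pi_add_arg hp).symm

/-- The point at which the ratio `y : 1 - y` divides the counterclockwise arc from `e` to `f`.
Relative positions make one parameter interval serve for all arcs of a moving family. -/
noncomputable def arcPoint (e f : Circle) (y : ℝ) : Circle :=
  Circle.exp (y * Circle.angleDiff e f) * e

lemma arcPoint_zero (e f : Circle) : arcPoint e f 0 = e := by
  rw [arcPoint, zero_mul, Circle.exp_zero, one_mul]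

lemma arcPoint_one (e f : Circle) : arcPoint e f 1 = f := by
  rw [arcPoint, one_mul, Circle.exp_angleDiff_mul]

lemma arcPoint_eq_exp_neg_mul (e f : Circle) (y : ℝ) :
    arcPoint e f y = Circle.exp (-((1 - y) * Circle.angleDiff e f)) * f := by
  have hsplit : y * Circle.angleDiff e f =
      -((1 - y) * Circle.angleDiff e f) + Circle.angleDiff e f := by ring
  rw [arcPoint, hsplit, Circle.exp_add, mul_assoc, Circle.exp_angleDiff_mul]

lemma exists_arcPoint_eq (h₀ : 0 < Circle.angleDiff e g)
    (h₁ : Circle.angleDiff e g < Circle.angleDiff e f) :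
    ∃ y ∈ Set.Ioo (0 : ℝ) 1, arcPoint e f y = g := by
  have hpos := h₀.trans h₁
  refine ⟨Circle.angleDiff e g / Circle.angleDiff e f, ⟨by positivity, (div_lt_one hpos).2 h₁⟩, ?_⟩
  rw [arcPoint, div_mul_cancel₀ _ hpos.ne', Circle.exp_angleDiff_mul]

lemma continuousOn_arcPoint {e f : ℝ → Circle} {K : Set ℝ} (he : ContinuousOn e K)
    (hef : ContinuousOn (fun t => Circle.angleDiff (e t) (f t)) K) (L : Set ℝ) :
    ContinuousOn (fun p : ℝ × ℝ => arcPoint (e p.1) (f p.1) p.2) (K ×ˢ L) := by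
  have hfst : Set.MapsTo Prod.fst (K ×ˢ L) K := fun p hp => hp.1
  exact (Circle.exp.continuous.comp_continuousOn
    (continuousOn_snd.mul (hef.comp continuousOn_fst hfst))).mul (he.comp continuousOn_fst hfst)

end Arcs

/-! ### Two intersections that collide -/

lemma forall_neg_of_exists_neg {α : Type*} [TopologicalSpace α] {K : Set α} {f : α → ℝ}
    (hK : IsPreconnected K) (hf : ContinuousOn f K) (hne : ∀ t ∈ K, f t ≠ 0)
    (hneg : ∃ t ∈ K, f t < 0) : ∀ t ∈ K, f t < 0 := by
  intro t ht
  by_contra! hnonneg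
  obtain ⟨u, hu, hneg⟩ := hneg
  obtain ⟨w, hw, hzero⟩ := hK.intermediate_value hu ht hf ⟨hneg.le, hnonneg⟩
  exact hne w hw hzero

lemma forall_neg_of_eventually_sign_eq {a b : ℝ} (hab : a < b) {f g : ℝ → ℝ}
    (hf : ContinuousOn f (Set.Ico a b)) (hg : ContinuousOn g (Set.Ico a b))
    (hf₀ : ∀ t ∈ Set.Ico a b, f t ≠ 0) (hg₀ : ∀ t ∈ Set.Ico a b, g t ≠ 0)
    (hsign : ∀ᶠ t in 𝓝[<] b, SignType.sign (f t) = SignType.sign (g t)) (hfa : f a < 0) :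
    (∀ t ∈ Set.Ico a b, f t < 0) ∧ ∀ t ∈ Set.Ico a b, g t < 0 := by
  have hfneg := forall_neg_of_exists_neg isPreconnected_Ico hf hf₀
    ⟨a, Set.left_mem_Ico.2 hab, hfa⟩
  obtain ⟨u, heq, hu⟩ := (hsign.and (Ico_mem_nhdsLT hab)).exists
  refine ⟨hfneg, forall_neg_of_exists_neg isPreconnected_Ico hg hg₀ ⟨u, hu, ?_⟩⟩
  rw [← sign_eq_neg_one_iff, ← heq, sign_neg (hfneg u hu)]

section Collision

variable {S S₁ S₂ S₃ T : Hyp} {b : ℝ} {e e₁ e₃ : ℝ → Circle} {l : Filter ℝ} {v : Circle}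

lemma eventually_sign_gap {θ : ℝ → ℝ} (hl : l ≤ 𝓝 b) (hθ : Tendsto θ l (𝓝 0))
    (he : Tendsto e l (𝓝 v)) (hgap : ∀ᶠ t in l, gap S T t (e t) = 0)
    (hσ : ⟪gapVec S T b, Complex.I * v⟫ ≠ 0) :
    ∀ᶠ t in l, SignType.sign (gap S T t (Circle.exp (θ t) * e t)) =
      SignType.sign (θ t) * SignType.sign ⟪gapVec S T b, Complex.I * v⟫ :=
  eventually_sign_add_inner_exp_mul hθ (((continuous_gapConst S T).tendsto b).mono_left hl)
    ((((continuous_gapVec S T).tendsto b).mono_left hl).inner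
      (((continuous_subtype_val.tendsto v).comp he).const_mul Complex.I)) hσ hgap

lemma exp_arg_div_mul (e f : Circle) :
    Circle.exp (Complex.arg ((f / e : Circle) : ℂ)) * e = f := by
  rw [Circle.exp_arg, div_mul_cancel]

lemma exp_neg_arg_div_mul (e f : Circle) :
    Circle.exp (-Complex.arg ((f / e : Circle) : ℂ)) * f = e := by
  rw [Circle.exp_neg, Circle.exp_arg, inv_div, div_mul_cancel]

lemma tendsto_arg_div (he₁ : Tendsto e₁ l (𝓝 v)) (he₃ : Tendsto e₃ l (𝓝 v)) :
    Tendsto (fun t => Complex.arg ((e₃ t / e₁ t : Circle) : ℂ)) l (𝓝 0) := by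
  have hdiv := he₃.div' he₁
  rw [div_self'] at hdiv
  have harg := (Complex.continuousAt_arg Complex.one_mem_slitPlane).tendsto.comp
    ((continuous_subtype_val.tendsto (1 : Circle)).comp hdiv)
  rwa [Complex.arg_one] at harg

/-- Both signs are that of the angle from `e₃ t` to `e₁ t`, since the slopes are opposite. -/
lemma eventually_sign_gap_eq_sign_gap (hl : l ≤ 𝓝 b)
    (he₁ : Tendsto e₁ l (𝓝 v)) (he₃ : Tendsto e₃ l (𝓝 v))
    (hgap₁ : ∀ᶠ t in l, gap S₂ S₁ t (e₁ t) = 0) (hgap₃ : ∀ᶠ t in l, gap S₂ S₃ t (e₃ t) = 0)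
    (hσ₁ : ⟪gapVec S₂ S₁ b, Complex.I * v⟫ < 0) (hσ₃ : 0 < ⟪gapVec S₂ S₃ b, Complex.I * v⟫) :
    ∀ᶠ t in l, SignType.sign (gap S₂ S₁ t (e₃ t)) =
        -SignType.sign (Complex.arg ((e₃ t / e₁ t : Circle) : ℂ)) ∧
      SignType.sign (gap S₂ S₃ t (e₁ t)) =
        -SignType.sign (Complex.arg ((e₃ t / e₁ t : Circle) : ℂ)) := by
  have hθ := tendsto_arg_div he₁ he₃
  have hθ_neg := hθ.neg
  rw [neg_zero] at hθ_neg
  filter_upwards [eventually_sign_gap hl hθ he₁ hgap₁ hσ₁.ne,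
    eventually_sign_gap hl hθ_neg he₃ hgap₃ hσ₃.ne'] with t h₁ h₃
  rw [exp_arg_div_mul, sign_neg hσ₁, mul_neg_one] at h₁
  rw [exp_neg_arg_div_mul, sign_pos hσ₃, mul_one, Left.sign_neg] at h₃
  exact ⟨h₁, h₃⟩

lemma tendsto_angleDiff_of_eventually_arg_pos (he₁ : Tendsto e₁ l (𝓝 v))
    (he₃ : Tendsto e₃ l (𝓝 v))
    (hpos : ∀ᶠ t in l, 0 < Complex.arg ((e₃ t / e₁ t : Circle) : ℂ)) :
    Tendsto (fun t => Circle.angleDiff (e₁ t) (e₃ t)) l (𝓝 0) := by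
  refine (tendsto_arg_div he₁ he₃).congr' ?_
  filter_upwards [hpos] with t ht
  exact (angleDiff_eq_of_exp_mul ht.le
    (by linarith [Complex.arg_le_pi ((e₃ t / e₁ t : Circle) : ℂ), Real.pi_pos])
    (exp_arg_div_mul (e₁ t) (e₃ t))).symm

end Collision

/-- Directions `e₁ t` and `e₃ t` in which the beach ellipse of `S₂` meets those of `S₁` and `S₃`.
They first coincide at `t = b`. The signs of the slopes say that the ellipse of `S₂` gets outside
the one of `S₁` counterclockwise of `e₁ t` and outside the one of `S₃` clockwise of `e₃ t`. -/
structure CollidingMeets (S₁ S₂ S₃ : Hyp) (a b : ℝ) (e₁ e₃ : ℝ → Circle) : Prop where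
  continuousOn_left : ContinuousOn e₁ (Set.Icc a b)
  continuousOn_right : ContinuousOn e₃ (Set.Icc a b)
  eq_end : e₁ b = e₃ b
  gap_left : ∀ t ∈ Set.Icc a b, gap S₂ S₁ t (e₁ t) = 0
  gap_right : ∀ t ∈ Set.Icc a b, gap S₂ S₃ t (e₃ t) = 0
  gap_left_ne : ∀ t ∈ Set.Ico a b, gap S₂ S₁ t (e₃ t) ≠ 0
  gap_right_ne : ∀ t ∈ Set.Ico a b, gap S₂ S₃ t (e₁ t) ≠ 0
  slope_left : ∀ t ∈ Set.Icc a b, ⟪gapVec S₂ S₁ t, Complex.I * e₁ t⟫ ≤ 0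
  slope_right : ∀ t ∈ Set.Icc a b, 0 ≤ ⟪gapVec S₂ S₃ t, Complex.I * e₃ t⟫
  slope_left_end : ⟪gapVec S₂ S₁ b, Complex.I * e₁ b⟫ < 0
  slope_right_end : 0 < ⟪gapVec S₂ S₃ b, Complex.I * e₃ b⟫

/-- The ends `e₁ t` and `e₃ t` of an arc that shrinks to a point as `t` increases to `b`, and on
which the beach ellipse of `S₂` is outside the one of `S₁`, which it meets at `e₁ t`, and outside
the one of `S₃`, which it meets at `e₃ t`. -/
structure MovingArc (S₁ S₂ S₃ : Hyp) (a b : ℝ) (e₁ e₃ : ℝ → Circle) : Prop where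
  continuousOn_left : ContinuousOn e₁ (Set.Icc a b)
  continuousOn_right : ContinuousOn e₃ (Set.Icc a b)
  continuousOn_length : ContinuousOn (fun t => Circle.angleDiff (e₁ t) (e₃ t)) (Set.Icc a b)
  eq_end : e₁ b = e₃ b
  ne : ∀ t ∈ Set.Ico a b, e₁ t ≠ e₃ t
  gap_left : ∀ t ∈ Set.Icc a b, gap S₂ S₁ t (e₁ t) = 0
  gap_right : ∀ t ∈ Set.Icc a b, gap S₂ S₃ t (e₃ t) = 0
  gap_left_neg : ∀ t ∈ Set.Ico a b, ∀ y ∈ Set.Ioc (0 : ℝ) 1,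
    gap S₂ S₁ t (arcPoint (e₁ t) (e₃ t) y) < 0
  gap_right_neg : ∀ t ∈ Set.Ico a b, ∀ y ∈ Set.Ico (0 : ℝ) 1,
    gap S₂ S₃ t (arcPoint (e₁ t) (e₃ t) y) < 0

lemma continuousOn_gap {α : Type*} [TopologicalSpace α] {K : Set α} {s : α → ℝ} {e : α → Circle}
    (S T : Hyp) (hs : ContinuousOn s K) (he : ContinuousOn e K) :
    ContinuousOn (fun p => gap S T (s p) (e p)) K :=
  Continuous.comp_continuousOn (g := fun p : ℝ × Circle => gap S T p.1 p.2)
    (f := fun p => (s p, e p)) (continuous_gap S T) (hs.prodMk he)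

section CollidingMeets

variable {S₁ S₂ S₃ : Hyp} {a b : ℝ} {e₁ e₃ : ℝ → Circle}

lemma CollidingMeets.tendsto (h : CollidingMeets S₁ S₂ S₃ a b e₁ e₃) (hab : a < b) :
    Tendsto e₁ (𝓝[<] b) (𝓝 (e₁ b)) ∧ Tendsto e₃ (𝓝[<] b) (𝓝 (e₁ b)) := by
  have hb : b ∈ Set.Icc a b := Set.right_mem_Icc.2 hab.le
  have hle : 𝓝[<] b ≤ 𝓝[Set.Icc a b] b :=
    nhdsWithin_le_of_mem (mem_of_superset (Ico_mem_nhdsLT hab) Set.Ico_subset_Icc_self)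
  have hright := (h.continuousOn_right b hb).mono_left hle
  rw [← h.eq_end] at hright
  exact ⟨(h.continuousOn_left b hb).mono_left hle, hright⟩

lemma CollidingMeets.ne (h : CollidingMeets S₁ S₂ S₃ a b e₁ e₃) {t : ℝ} (ht : t ∈ Set.Ico a b) :
    e₁ t ≠ e₃ t :=
  fun heq => h.gap_left_ne t ht (heq ▸ h.gap_left t (Set.Ico_subset_Icc_self ht))

lemma CollidingMeets.eventually_sign (h : CollidingMeets S₁ S₂ S₃ a b e₁ e₃) (hab : a < b) :
    ∀ᶠ t in 𝓝[<] b, SignType.sign (gap S₂ S₁ t (e₃ t)) =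
        -SignType.sign (Complex.arg ((e₃ t / e₁ t : Circle) : ℂ)) ∧
      SignType.sign (gap S₂ S₃ t (e₁ t)) =
        -SignType.sign (Complex.arg ((e₃ t / e₁ t : Circle) : ℂ)) := by
  have hIcc : ∀ᶠ t in 𝓝[<] b, t ∈ Set.Icc a b :=
    mem_of_superset (Ico_mem_nhdsLT hab) Set.Ico_subset_Icc_self
  obtain ⟨hleft, hright⟩ := h.tendsto hab
  exact eventually_sign_gap_eq_sign_gap nhdsWithin_le_nhds hleft hright
    (hIcc.mono h.gap_left) (hIcc.mono h.gap_right) h.slope_left_end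
    (h.eq_end ▸ h.slope_right_end)

lemma CollidingMeets.gap_neg (h : CollidingMeets S₁ S₂ S₃ a b e₁ e₃) (hab : a < b)
    (ha : gap S₂ S₁ a (e₃ a) < 0 ∨ gap S₂ S₃ a (e₁ a) < 0) :
    (∀ t ∈ Set.Ico a b, gap S₂ S₁ t (e₃ t) < 0) ∧
      ∀ t ∈ Set.Ico a b, gap S₂ S₃ t (e₁ t) < 0 := by
  have hleft := continuousOn_gap S₂ S₁ continuousOn_id
    (h.continuousOn_right.mono Set.Ico_subset_Icc_self)
  have hright := continuousOn_gap S₂ S₃ continuousOn_id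
    (h.continuousOn_left.mono Set.Ico_subset_Icc_self)
  have hsign := h.eventually_sign hab
  rcases ha with ha | ha
  · exact forall_neg_of_eventually_sign_eq hab hleft hright h.gap_left_ne h.gap_right_ne
      (hsign.mono fun t ht => ht.1.trans ht.2.symm) ha
  · exact (forall_neg_of_eventually_sign_eq hab hright hleft h.gap_right_ne h.gap_left_ne
      (hsign.mono fun t ht => ht.2.trans ht.1.symm) ha).symm

lemma CollidingMeets.continuousOn_angleDiff (h : CollidingMeets S₁ S₂ S₃ a b e₁ e₃)
    (hab : a < b) (hneg : ∀ t ∈ Set.Ico a b, gap S₂ S₁ t (e₃ t) < 0) :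
    ContinuousOn (fun t => Circle.angleDiff (e₁ t) (e₃ t)) (Set.Icc a b) := by
  intro t ht
  rcases ht.2.lt_or_eq with hlt | rfl
  · exact (continuousAt_angleDiff (h.ne ⟨ht.1, hlt⟩)).comp_continuousWithinAt
      (f := fun t => (e₁ t, e₃ t)) ((h.continuousOn_left t ht).prodMk (h.continuousOn_right t ht))
  · obtain ⟨hleft, hright⟩ := h.tendsto hab
    have hpos : ∀ᶠ u in 𝓝[<] t, 0 < Complex.arg ((e₃ u / e₁ u : Circle) : ℂ) := by
      filter_upwards [h.eventually_sign hab, Ico_mem_nhdsLT hab] with u hu hmem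
      rw [sign_neg (hneg u hmem), neg_inj, eq_comm, sign_eq_one_iff] at hu
      exact hu.1
    rw [← Set.Ico_insert_right hab.le, continuousWithinAt_insert_self, ContinuousWithinAt,
      ← h.eq_end, angleDiff_self, nhdsWithin_Ico_eq_nhdsLT hab]
    exact tendsto_angleDiff_of_eventually_arg_pos hleft hright hpos

lemma CollidingMeets.movingArc (h : CollidingMeets S₁ S₂ S₃ a b e₁ e₃) (hab : a < b)
    (ha : gap S₂ S₁ a (e₃ a) < 0 ∨ gap S₂ S₃ a (e₁ a) < 0) :
    MovingArc S₁ S₂ S₃ a b e₁ e₃ := by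
  obtain ⟨hleft, hright⟩ := h.gap_neg hab ha
  refine ⟨h.continuousOn_left, h.continuousOn_right, h.continuousOn_angleDiff hab hleft, h.eq_end,
    fun t ht => h.ne ht, h.gap_left, h.gap_right, fun t ht y hy => ?_, fun t ht y hy => ?_⟩
  all_goals
    have hIcc := Set.Ico_subset_Icc_self ht
    have hpos := Circle.angleDiff_pos (h.ne ht)
  · have hneg := hleft t ht
    rw [← arcPoint_one (e₁ t) (e₃ t), arcPoint, one_mul] at hneg
    exact add_inner_exp_mul_neg (h.gap_left t hIcc) (h.slope_left t hIcc) (mul_pos hy.1 hpos)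
      (mul_le_of_le_one_left hpos.le hy.2) (Circle.angleDiff_lt_two_pi _ _) hneg
  · have hneg := hright t ht
    rw [← arcPoint_zero (e₁ t) (e₃ t), arcPoint_eq_exp_neg_mul, sub_zero, one_mul] at hneg
    rw [arcPoint_eq_exp_neg_mul]
    exact add_inner_exp_neg_mul_neg (h.gap_right t hIcc) (h.slope_right t hIcc)
      (mul_pos (sub_pos.2 hy.2) hpos) (mul_le_of_le_one_left hpos.le (sub_le_self 1 hy.1))
      (Circle.angleDiff_lt_two_pi _ _) hneg

end CollidingMeets

section MovingArc

variable {S₁ S₂ S₃ : Hyp} {a a' b t : ℝ} {e₁ e₃ : ℝ → Circle}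

lemma MovingArc.mono (h : MovingArc S₁ S₂ S₃ a b e₁ e₃) (ha : a ≤ a') :
    MovingArc S₁ S₂ S₃ a' b e₁ e₃ := by
  have hIcc : Set.Icc a' b ⊆ Set.Icc a b := Set.Icc_subset_Icc_left ha
  have hIco : Set.Ico a' b ⊆ Set.Ico a b := Set.Ico_subset_Ico_left ha
  exact ⟨h.continuousOn_left.mono hIcc, h.continuousOn_right.mono hIcc,
    h.continuousOn_length.mono hIcc, h.eq_end, fun t ht => h.ne t (hIco ht),
    fun t ht => h.gap_left t (hIcc ht), fun t ht => h.gap_right t (hIcc ht),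
    fun t ht => h.gap_left_neg t (hIco ht), fun t ht => h.gap_right_neg t (hIco ht)⟩

lemma MovingArc.gap_left_nonpos (h : MovingArc S₁ S₂ S₃ a b e₁ e₃) (ht : t ∈ Set.Ico a b) {y : ℝ}
    (hy : y ∈ Set.Icc (0 : ℝ) 1) : gap S₂ S₁ t (arcPoint (e₁ t) (e₃ t) y) ≤ 0 := by
  rcases hy.1.eq_or_lt with rfl | hpos
  · rw [arcPoint_zero]
    exact (h.gap_left t (Set.Ico_subset_Icc_self ht)).le
  · exact (h.gap_left_neg t ht y ⟨hpos, hy.2⟩).le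

lemma MovingArc.gap_right_nonpos (h : MovingArc S₁ S₂ S₃ a b e₁ e₃) (ht : t ∈ Set.Ico a b) {y : ℝ}
    (hy : y ∈ Set.Icc (0 : ℝ) 1) : gap S₂ S₃ t (arcPoint (e₁ t) (e₃ t) y) ≤ 0 := by
  rcases hy.2.eq_or_lt with rfl | hlt
  · rw [arcPoint_one]
    exact (h.gap_right t (Set.Ico_subset_Icc_self ht)).le
  · exact (h.gap_right_neg t ht y ⟨hy.1, hlt⟩).le

lemma MovingArc.continuousOn_gap (h : MovingArc S₁ S₂ S₃ a b e₁ e₃) (T : Hyp) (L : Set ℝ) :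
    ContinuousOn (fun p : ℝ × ℝ => gap S₂ T p.1 (arcPoint (e₁ p.1) (e₃ p.1) p.2))
      (Set.Icc a b ×ˢ L) :=
  HypSweep.continuousOn_gap S₂ T continuousOn_fst
    (continuousOn_arcPoint h.continuousOn_left h.continuousOn_length L)

end MovingArc

/-! ### The other sites -/

lemma exists_last_nonneg {ι X : Type*} [TopologicalSpace X] [T2Space X] {O : Set ι} {K : Set X}
    {F : ι → X → ℝ} {τ : X → ℝ} (hO : O.Finite) (hK : IsCompact K)
    (hF : ∀ i ∈ O, ContinuousOn (F i) K) (hτ : ContinuousOn τ K)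
    (hne : ∃ i ∈ O, ∃ p ∈ K, 0 ≤ F i p) :
    ∃ i ∈ O, ∃ p ∈ K, 0 ≤ F i p ∧ ∀ j ∈ O, ∀ q ∈ K, τ p < τ q → F j q < 0 := by
  have hcompact : IsCompact (⋃ i ∈ O, K ∩ F i ⁻¹' Set.Ici 0) :=
    hO.isCompact_biUnion fun i hi => hK.of_isClosed_subset
      ((hF i hi).preimage_isClosed_of_isClosed hK.isClosed isClosed_Ici) Set.inter_subset_left
  have hsub : (⋃ i ∈ O, K ∩ F i ⁻¹' Set.Ici 0) ⊆ K :=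
    Set.iUnion₂_subset fun i _ => Set.inter_subset_left
  obtain ⟨i₀, hi₀, p₀, hp₀, hnonneg⟩ := hne
  obtain ⟨p, hp, hmax⟩ := hcompact.exists_isMaxOn
    ⟨p₀, Set.mem_biUnion hi₀ ⟨hp₀, hnonneg⟩⟩ (hτ.mono hsub)
  obtain ⟨i, hi, hpK, hpF⟩ := Set.mem_iUnion₂.1 hp
  refine ⟨i, hi, p, hpK, hpF, fun j hj q hq hlt => ?_⟩
  by_contra! hqF
  exact (hmax (Set.mem_biUnion hj ⟨hq, hqF⟩)).not_gt hlt

section Touch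

variable {𝒮 : Finset Hyp} {S T A B : Hyp} {t y : ℝ} {e f : Circle}

lemma radius_eq_of_gapDisc_eq_zero (hST : S ≠ T) (ht : 0 ≤ t) (hS : radius S < t)
    (h : gapDisc S T t = 0) : radius T = t := by
  by_contra! hne
  have hcosh : Real.cosh t - timeCoord T ≠ 0 := fun h =>
    hne (Real.cosh_strictMonoOn.injOn (radius_nonneg T) ht (sub_eq_zero.1 h).symm)
  have hdist_ne := (sub_pos.2 (Real.one_lt_cosh.2 (hdist_pos hST).ne')).ne'
  exact mul_ne_zero (mul_ne_zero (mul_ne_zero two_ne_zero hdist_ne)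
    (cosh_sub_timeCoord_pos hS).ne') hcosh h

lemma angleDiff_arcPoint (hef : e ≠ f) (hy : y ∈ Set.Icc (0 : ℝ) 1) :
    Circle.angleDiff e (arcPoint e f y) = y * Circle.angleDiff e f := by
  have hpos := Circle.angleDiff_pos hef
  exact angleDiff_eq_of_exp_mul (mul_nonneg hy.1 hpos.le)
    ((mul_le_of_le_one_left hpos.le hy.2).trans_lt (Circle.angleDiff_lt_two_pi e f)) rfl

lemma exp_mul_arcPoint (hef : e ≠ f) (x y : ℝ) :
    Circle.exp x * arcPoint e f y = arcPoint e f (y + x / Circle.angleDiff e f) := by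
  rw [arcPoint, arcPoint, ← mul_assoc, ← Circle.exp_add, add_mul,
    div_mul_cancel₀ _ (Circle.angleDiff_pos hef).ne', add_comm]

/-- At an interior zero of the nonpositive function `gap` its slope vanishes. -/
lemma radius_eq_of_touch (hST : S ≠ T) (hS : radius S < t) (hef : e ≠ f)
    (hnonpos : ∀ z ∈ Set.Icc (0 : ℝ) 1, gap S T t (arcPoint e f z) ≤ 0)
    (hy : y ∈ Set.Ioo (0 : ℝ) 1) (hzero : gap S T t (arcPoint e f y) = 0) : radius T = t := by
  refine radius_eq_of_gapDisc_eq_zero hST ((radius_nonneg S).trans hS.le) hS ?_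
  rw [← inner_gapVec_I_mul_sq hzero, sq_eq_zero_iff]
  refine inner_I_mul_eq_zero_of_isLocalMax (c := gapConst S T t) ?_
  have hshift : Tendsto (fun x : ℝ => y + x / Circle.angleDiff e f) (𝓝 0) (𝓝 y) :=
    Continuous.tendsto' (by fun_prop) _ _ (by rw [zero_div, add_zero])
  filter_upwards [hshift.eventually (Icc_mem_nhds hy.1 hy.2)] with x hx
  rw [Circle.exp_zero, one_mul]
  refine le_of_le_of_eq ?_ hzero.symm
  rw [exp_mul_arcPoint hef]
  exact hnonpos _ hx

/-- The point where the three ellipses meet has `S`, `A` and `B` as closest sites, so it is a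
Voronoi vertex, and the sweep circle touches its witness circle. -/
lemma mem_eventRadii_of_gap_eq_zero (hS : S ∈ 𝒮) (hA : A ∈ 𝒮) (hB : B ∈ 𝒮) (hSA : S ≠ A)
    (hSB : S ≠ B) (hAB : A ≠ B) (hSt : radius S < t) (hgapA : gap S A t e = 0)
    (hgapB : gap S B t e = 0) (hnonpos : ∀ U ∈ 𝒮, gap S U t e ≤ 0) : t ∈ eventRadii 𝒮 := by
  have hdist_eq : ∀ {U}, gap S U t e = 0 →
      hdist (ellipsePoint t S e) U = t - ellipseRadius t S e := fun h => by
    rw [← radius_ellipsePoint hSt e]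
    exact (gap_eq_zero_iff hSt).1 h
  have hincident : ∀ {U}, U ∈ 𝒮 → gap S U t e = 0 →
      U ∈ incidentSites 𝒮 (ellipsePoint t S e) := fun hU h => by
    refine ⟨hU, fun T hT => ?_⟩
    rw [hdist_eq h]
    exact not_lt.1 ((gap_pos_iff hSt).not.1 (hnonpos T hT).not_gt)
  have hevent := radius_add_hdist_mem_eventRadii (𝒮 := 𝒮) (W := ellipsePoint t S e) hSA hSB hAB
    (by rintro U (rfl | rfl | rfl)
        exacts [hincident hS (gap_self _ t e), hincident hA hgapA, hincident hB hgapB])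
  rwa [hdist_eq (gap_self S t e), radius_ellipsePoint hSt, add_sub_cancel] at hevent

end Touch

/-- A moving arc that ends at a direction in which the beach ellipses of the other sites are
strictly inside, without events in between. -/
structure ClearArc (𝒮 : Finset Hyp) (S₁ S₂ S₃ : Hyp) (r b : ℝ) (e₁ e₃ : ℝ → Circle) : Prop
    extends MovingArc S₁ S₂ S₃ r b e₁ e₃ where
  mem_left : S₁ ∈ 𝒮
  mem_middle : S₂ ∈ 𝒮
  mem_right : S₃ ∈ 𝒮
  ne_left : S₂ ≠ S₁
  ne_right : S₂ ≠ S₃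
  radius_lt : radius S₂ < r
  gap_end_neg : ∀ T ∈ (𝒮 : Set Hyp) \ {S₁, S₂, S₃}, gap S₂ T b (e₁ b) < 0
  not_event : ∀ q ∈ Set.Ioo r b, q ∉ eventRadii 𝒮

section OtherSites

variable {𝒮 : Finset Hyp} {S₁ S₂ S₃ T : Hyp} {r b t y : ℝ} {e₁ e₃ : ℝ → Circle}

lemma MovingArc.gap_nonpos_of_later (h : MovingArc S₁ S₂ S₃ r b e₁ e₃) (ht : t ∈ Set.Ico r b)
    (hlater : ∀ u ∈ Set.Ioo t b, gap S₂ T u (arcPoint (e₁ u) (e₃ u) y) < 0) :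
    gap S₂ T t (arcPoint (e₁ t) (e₃ t) y) ≤ 0 := by
  have hcont : ContinuousOn (fun u => gap S₂ T u (arcPoint (e₁ u) (e₃ u) y)) (Set.Icc r b) :=
    (h.continuousOn_gap T {y}).comp (f := fun u => (u, y))
      (continuousOn_id.prodMk continuousOn_const) fun u hu => ⟨hu, rfl⟩
  have hlim := (hcont t (Set.Ico_subset_Icc_self ht)).mono_left (nhdsWithin_mono t
    ((Set.Ioo_subset_Ioo_left ht.1).trans Set.Ioo_subset_Icc_self : Set.Ioo t b ⊆ _))
  rw [nhdsWithin_Ioo_eq_nhdsGT ht.2] at hlim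
  refine le_of_tendsto hlim ?_
  filter_upwards [Ioo_mem_nhdsGT ht.2] with u hu
  exact (hlater u hu).le

lemma MovingArc.eventually_arcPoint_eq (h : MovingArc S₁ S₂ S₃ r b e₁ e₃) (ht : t ∈ Set.Ico r b)
    (hy : y ∈ Set.Ioo (0 : ℝ) 1) : ∀ᶠ u in 𝓝[>] t,
      ∃ z ∈ Set.Ioo (0 : ℝ) 1, arcPoint (e₁ u) (e₃ u) z = arcPoint (e₁ t) (e₃ t) y := by
  have htIcc := Set.Ico_subset_Icc_self ht
  have hle : 𝓝[>] t ≤ 𝓝[Set.Icc r b] t := by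
    rw [← nhdsWithin_Ioo_eq_nhdsGT ht.2]
    exact nhdsWithin_mono t ((Set.Ioo_subset_Ioo_left ht.1).trans Set.Ioo_subset_Icc_self)
  have hlength := Circle.angleDiff_pos (h.ne t ht)
  have hangle := angleDiff_arcPoint (h.ne t ht) (Set.Ioo_subset_Icc_self hy)
  have hpos : 0 < Circle.angleDiff (e₁ t) (arcPoint (e₁ t) (e₃ t) y) :=
    hangle ▸ mul_pos hy.1 hlength
  have hlt : Circle.angleDiff (e₁ t) (arcPoint (e₁ t) (e₃ t) y) <
      Circle.angleDiff (e₁ t) (e₃ t) := hangle ▸ mul_lt_of_lt_one_left hlength hy.2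
  have hne : e₁ t ≠ arcPoint (e₁ t) (e₃ t) y := fun heq =>
    hpos.ne' (by rw [← heq, angleDiff_self])
  have hlim : Tendsto (fun u => Circle.angleDiff (e₁ u) (arcPoint (e₁ t) (e₃ t) y)) (𝓝[>] t)
      (𝓝 (Circle.angleDiff (e₁ t) (arcPoint (e₁ t) (e₃ t) y))) :=
    (continuousAt_angleDiff hne).tendsto.comp
      (((h.continuousOn_left t htIcc).mono_left hle).prodMk_nhds tendsto_const_nhds)
  filter_upwards [hlim.eventually_const_lt hpos,
    hlim.eventually_lt ((h.continuousOn_length t htIcc).mono_left hle) hlt] with u hu₀ hu₁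
  exact exists_arcPoint_eq hu₀ hu₁

lemma ClearArc.gap_nonpos_of_others (h : ClearArc 𝒮 S₁ S₂ S₃ r b e₁ e₃) (ht : t ∈ Set.Ico r b)
    (hy : y ∈ Set.Icc (0 : ℝ) 1)
    (hothers : ∀ U ∈ (𝒮 : Set Hyp) \ {S₁, S₂, S₃}, gap S₂ U t (arcPoint (e₁ t) (e₃ t) y) ≤ 0)
    (hT : T ∈ 𝒮) : gap S₂ T t (arcPoint (e₁ t) (e₃ t) y) ≤ 0 := by
  by_cases hmem : T ∈ ({S₁, S₂, S₃} : Set Hyp)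
  · rcases hmem with rfl | rfl | rfl
    exacts [h.gap_left_nonpos ht hy, (gap_self _ _ _).le, h.gap_right_nonpos ht hy]
  · exact hothers T ⟨hT, hmem⟩

lemma ClearArc.mem_eventRadii (h : ClearArc 𝒮 S₁ S₂ S₃ r b e₁ e₃) (ht : t ∈ Set.Ico r b)
    (hnonpos : ∀ U ∈ 𝒮, ∀ z ∈ Set.Icc (0 : ℝ) 1, gap S₂ U t (arcPoint (e₁ t) (e₃ t) z) ≤ 0)
    (hT : T ∈ (𝒮 : Set Hyp) \ {S₁, S₂, S₃}) (hy : y ∈ Set.Icc (0 : ℝ) 1)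
    (hzero : gap S₂ T t (arcPoint (e₁ t) (e₃ t) y) = 0) : t ∈ eventRadii 𝒮 := by
  obtain ⟨hT𝒮, hTS⟩ := hT
  simp only [Set.mem_insert_iff, Set.mem_singleton_iff, not_or] at hTS
  obtain ⟨hTS₁, hTS₂, hTS₃⟩ := hTS
  have htIcc := Set.Ico_subset_Icc_self ht
  have hS₂ := h.radius_lt.trans_le ht.1
  rcases hy.1.eq_or_lt with rfl | hy₀
  · exact mem_eventRadii_of_gap_eq_zero h.mem_middle h.mem_left hT𝒮 h.ne_left (Ne.symm hTS₂)
      (Ne.symm hTS₁) hS₂ (by rw [arcPoint_zero, h.gap_left t htIcc]) hzero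
      fun U hU => hnonpos U hU 0 hy
  rcases hy.2.eq_or_lt with rfl | hy₁
  · exact mem_eventRadii_of_gap_eq_zero h.mem_middle h.mem_right hT𝒮 h.ne_right (Ne.symm hTS₂)
      (Ne.symm hTS₃) hS₂ (by rw [arcPoint_one, h.gap_right t htIcc]) hzero
      fun U hU => hnonpos U hU 1 hy
  · rw [← radius_eq_of_touch (Ne.symm hTS₂) hS₂ (h.ne t ht) (hnonpos T hT𝒮) ⟨hy₀, hy₁⟩ hzero]
    exact radius_mem_eventRadii hT𝒮

/-- The last radius at which the ellipse of another site reaches the arc would be an event. -/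
lemma ClearArc.gap_neg_of_other (h : ClearArc 𝒮 S₁ S₂ S₃ r b e₁ e₃) (ht : t ∈ Set.Ioo r b)
    (hT : T ∈ (𝒮 : Set Hyp) \ {S₁, S₂, S₃}) (hy : y ∈ Set.Icc (0 : ℝ) 1) :
    gap S₂ T t (arcPoint (e₁ t) (e₃ t) y) < 0 := by
  by_contra! hnonneg
  have hcont : ∀ U ∈ (𝒮 : Set Hyp) \ {S₁, S₂, S₃}, ContinuousOn
      (fun p : ℝ × ℝ => gap S₂ U p.1 (arcPoint (e₁ p.1) (e₃ p.1) p.2))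
      (Set.Icc t b ×ˢ Set.Icc 0 1) := fun U _ => (h.continuousOn_gap U _).mono
    (Set.prod_mono_left (Set.Icc_subset_Icc_left ht.1.le))
  obtain ⟨U, hU, ⟨u, z⟩, ⟨hu, hz⟩, hUnonneg, hlast⟩ := exists_last_nonneg
    (𝒮.finite_toSet.subset Set.sdiff_subset) (isCompact_Icc.prod isCompact_Icc) hcont
    continuousOn_fst ⟨T, hT, (t, y), ⟨Set.left_mem_Icc.2 ht.2.le, hy⟩, hnonneg⟩
  have hub : u < b := by
    refine hu.2.lt_of_ne ?_
    rintro rfl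
    rw [← h.eq_end, arcPoint, angleDiff_self, mul_zero, Circle.exp_zero, one_mul] at hUnonneg
    exact (h.gap_end_neg U hU).not_ge hUnonneg
  have hIoo : u ∈ Set.Ioo r b := ⟨ht.1.trans_le hu.1, hub⟩
  have hIco := Set.Ioo_subset_Ico_self hIoo
  have hnonpos : ∀ W ∈ 𝒮, ∀ w ∈ Set.Icc (0 : ℝ) 1, gap S₂ W u (arcPoint (e₁ u) (e₃ u) w) ≤ 0 :=
    fun W hW w hw => h.gap_nonpos_of_others hIco hw (fun X hX => h.gap_nonpos_of_later hIco
      fun s hs => hlast X hX (s, w) ⟨⟨hu.1.trans hs.1.le, hs.2.le⟩, hw⟩ hs.1) hW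
  exact h.not_event u hIoo
    (h.mem_eventRadii hIco hnonpos hU hz (le_antisymm (hnonpos U hU.1 z hz) hUnonneg))

lemma ClearArc.gap_nonpos (h : ClearArc 𝒮 S₁ S₂ S₃ r b e₁ e₃) (ht : t ∈ Set.Ico r b)
    (hT : T ∈ 𝒮) (hy : y ∈ Set.Icc (0 : ℝ) 1) : gap S₂ T t (arcPoint (e₁ t) (e₃ t) y) ≤ 0 :=
  h.gap_nonpos_of_others ht hy (fun _ hU => h.gap_nonpos_of_later ht fun _ hu =>
    h.gap_neg_of_other ⟨ht.1.trans_lt hu.1, hu.2⟩ hU hy) hT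

/-- A site on the sweep circle in a direction inside the arc would, slightly later, still be in a
direction inside the arc, where its ellipse is the outer one. -/
lemma ClearArc.gap_ne_zero_of_radius_eq (h : ClearArc 𝒮 S₁ S₂ S₃ r b e₁ e₃)
    (ht : t ∈ Set.Ico r b) (hT : T ∈ (𝒮 : Set Hyp) \ {S₁, S₂, S₃}) (hTt : radius T = t)
    (hy : y ∈ Set.Ioo (0 : ℝ) 1) : gap S₂ T t (arcPoint (e₁ t) (e₃ t) y) ≠ 0 := by
  intro hzero
  have hS₂ := h.radius_lt.trans_le ht.1
  have hdir := (gap_eq_zero_iff_of_radius_eq hS₂ hTt).1 hzero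
  obtain ⟨u, ⟨z, hz, heq⟩, hu⟩ :=
    ((h.eventually_arcPoint_eq ht hy).and (Ioo_mem_nhdsGT ht.2)).exists
  have hneg := h.gap_neg_of_other ⟨ht.1.trans_lt hu.1, hu.2⟩ hT (Set.Ioo_subset_Icc_self hz)
  rw [heq, ← hdir] at hneg
  exact hneg.not_gt (gap_unitDir_pos (hTt.symm ▸ hS₂) (hTt.symm ▸ hu.1))

lemma ClearArc.gap_neg (h : ClearArc 𝒮 S₁ S₂ S₃ r b e₁ e₃) (ht : t ∈ Set.Ico r b)
    (hT : T ∈ 𝒮) (hTS₂ : T ≠ S₂) (hy : y ∈ Set.Ioo (0 : ℝ) 1) :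
    gap S₂ T t (arcPoint (e₁ t) (e₃ t) y) < 0 := by
  by_cases hmem : T ∈ ({S₁, S₂, S₃} : Set Hyp)
  · rcases hmem with rfl | rfl | rfl
    exacts [h.gap_left_neg t ht y (Set.Ioo_subset_Ioc_self hy), absurd rfl hTS₂,
      h.gap_right_neg t ht y (Set.Ioo_subset_Ico_self hy)]
  · refine (h.gap_nonpos ht hT (Set.Ioo_subset_Icc_self hy)).lt_of_ne fun hzero => ?_
    have hTt := radius_eq_of_touch hTS₂.symm (h.radius_lt.trans_le ht.1) (h.ne t ht)
      (fun z hz => h.gap_nonpos ht hT hz) hy hzero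
    exact h.gap_ne_zero_of_radius_eq ht ⟨hT, hmem⟩ hTt hy hzero

end OtherSites

section Consecutive

variable {𝒮 : Finset Hyp} {S T S₁ S₂ S₃ P X : Hyp} {r b t : ℝ} {e₁ e₃ : ℝ → Circle}

lemma radius_le_of_mem_beachEllipse (hP : P ∈ beachEllipse t S) : radius S ≤ t := by
  have hle := (neg_le_abs _).trans (abs_radius_sub_le_hdist P S)
  rw [show hdist P S = t - radius P from hP, neg_sub] at hle
  exact (sub_le_sub_iff_right _).1 hle

lemma mem_beachIntersections (hP : P ∈ beachCurve 𝒮 t) (hS : S ∈ 𝒮) (hT : T ∈ 𝒮) (hST : S ≠ T)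
    (hPST : P ∈ beachEllipse t S ∩ beachEllipse t T) : P ∈ beachIntersections 𝒮 t :=
  ⟨hP, S, ⟨hS, radius_le_of_mem_beachEllipse hPST.1⟩, T,
    ⟨hT, radius_le_of_mem_beachEllipse hPST.2⟩, hST, hPST⟩

lemma ClearArc.mem_beachEllipse_left (h : ClearArc 𝒮 S₁ S₂ S₃ r b e₁ e₃)
    (ht : t ∈ Set.Icc r b) :
    ellipsePoint t S₂ (e₁ t) ∈ beachEllipse t S₁ ∩ beachEllipse t S₂ :=
  have hS := h.radius_lt.trans_le ht.1
  ⟨(gap_eq_zero_iff hS).1 (h.gap_left t ht), ellipsePoint_mem_beachEllipse hS _⟩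

lemma ClearArc.mem_beachEllipse_right (h : ClearArc 𝒮 S₁ S₂ S₃ r b e₁ e₃)
    (ht : t ∈ Set.Icc r b) :
    ellipsePoint t S₂ (e₃ t) ∈ beachEllipse t S₂ ∩ beachEllipse t S₃ :=
  have hS := h.radius_lt.trans_le ht.1
  ⟨ellipsePoint_mem_beachEllipse hS _, (gap_eq_zero_iff hS).1 (h.gap_right t ht)⟩

lemma ClearArc.mem_beachCurve (h : ClearArc 𝒮 S₁ S₂ S₃ r b e₁ e₃) (ht : t ∈ Set.Ico r b) {y : ℝ}
    (hy : y ∈ Set.Icc (0 : ℝ) 1) :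
    ellipsePoint t S₂ (arcPoint (e₁ t) (e₃ t) y) ∈ beachCurve 𝒮 t :=
  ellipsePoint_mem_beachCurve h.mem_middle (h.radius_lt.trans_le ht.1)
    fun _ hU _ => h.gap_nonpos ht hU hy

lemma ClearArc.gap_neg_of_strictlyBetween (h : ClearArc 𝒮 S₁ S₂ S₃ r b e₁ e₃)
    (ht : t ∈ Set.Ico r b)
    (hX : StrictlyBetween (ellipsePoint t S₂ (e₁ t)) X (ellipsePoint t S₂ (e₃ t))) (hS : S ∈ 𝒮)
    (hne : S ≠ S₂) : gap S₂ S t (unitDir X) < 0 := by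
  have hS₂ := h.radius_lt.trans_le ht.1
  rw [StrictlyBetween, ccw_eq_angleDiff, ccw_eq_angleDiff, unitDir_ellipsePoint hS₂,
    unitDir_ellipsePoint hS₂] at hX
  obtain ⟨y, hy, hyX⟩ := exists_arcPoint_eq hX.1 hX.2
  exact hyX ▸ h.gap_neg ht hS hne hy

lemma ClearArc.mem_activePart (h : ClearArc 𝒮 S₁ S₂ S₃ r b e₁ e₃) (ht : t ∈ Set.Ico r b)
    (hX : X ∈ beachCurve 𝒮 t)
    (hbetween : StrictlyBetween (ellipsePoint t S₂ (e₁ t)) X (ellipsePoint t S₂ (e₃ t))) :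
    X ∈ activePart 𝒮 t S₂ :=
  mem_activePart_of_gap_neg h.mem_middle (h.radius_lt.trans_le ht.1)
    (fun _ hU _ hne => h.gap_neg_of_strictlyBetween ht hbetween hU hne) hX

lemma ClearArc.consecutive (h : ClearArc 𝒮 S₁ S₂ S₃ r b e₁ e₃) (ht : t ∈ Set.Ico r b) :
    Consecutive 𝒮 t (ellipsePoint t S₂ (e₁ t)) (ellipsePoint t S₂ (e₃ t)) := by
  have hS₂ := h.radius_lt.trans_le ht.1
  have hIcc := Set.Ico_subset_Icc_self ht
  have hcurve₁ := h.mem_beachCurve ht (Set.left_mem_Icc.2 zero_le_one)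
  have hcurve₃ := h.mem_beachCurve ht (Set.right_mem_Icc.2 zero_le_one)
  rw [arcPoint_zero] at hcurve₁
  rw [arcPoint_one] at hcurve₃
  refine ⟨mem_beachIntersections hcurve₁ h.mem_left h.mem_middle h.ne_left.symm
      (h.mem_beachEllipse_left hIcc),
    mem_beachIntersections hcurve₃ h.mem_middle h.mem_right h.ne_right
      (h.mem_beachEllipse_right hIcc), fun heq => h.ne t ht ?_, fun X hX hbetween => ?_⟩
  · rw [← unitDir_ellipsePoint hS₂ (e₁ t), heq, unitDir_ellipsePoint hS₂]
  · exact notMem_beachIntersections_of_gap_neg h.mem_middle hS₂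
      (fun _ hU _ hne => h.gap_neg_of_strictlyBetween ht hbetween hU hne) hX

lemma continuousOn_ellipsePoint {e : ℝ → Circle} {K : Set ℝ} (he : ContinuousOn e K)
    (hS : ∀ t ∈ K, radius S < t) : ContinuousOn (fun t => ellipsePoint t S (e t)) K :=
  fun t ht => ContinuousAt.comp_continuousWithinAt
    (g := fun p : ℝ × Circle => ellipsePoint p.1 S p.2) (f := fun t => (t, e t))
    (continuousAt_ellipsePoint (hS t ht) (e t)) (continuousWithinAt_id.prodMk (he t ht))

end Consecutive

/-! ### Three sites on a circle -/

section MeetDir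

variable {S T S₁ S₂ S₃ : Hyp} {a b t ε : ℝ} {v : Circle}

lemma gap_meetDir (hε : ε ^ 2 = 1) (hST : S ≠ T) (hS : radius S < t) (hT : radius T ≤ t) :
    gap S T t (meetDir S T ε t) = 0 :=
  ((eq_meetDir_iff hε hST hS hT).1 rfl).1

lemma inner_gapVec_I_mul_meetDir (hε : ε ^ 2 = 1) (hST : S ≠ T) (hS : radius S < t)
    (hT : radius T ≤ t) :
    ⟪gapVec S T t, Complex.I * meetDir S T ε t⟫ = ε * √(gapDisc S T t) :=
  ((eq_meetDir_iff hε hST hS hT).1 rfl).2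

lemma eq_meetDir_neg_one (hST : S ≠ T) (hS : radius S < t) (hT : radius T ≤ t)
    (hgap : gap S T t v = 0) (hslope : ⟪gapVec S T t, Complex.I * v⟫ < 0) :
    v = meetDir S T (-1) t := by
  rw [eq_meetDir_iff (by norm_num) hST hS hT, ← inner_gapVec_I_mul_sq hgap, Real.sqrt_sq_eq_abs,
    abs_of_neg hslope, neg_one_mul, neg_neg]
  exact ⟨hgap, rfl⟩

lemma eq_meetDir_one (hST : S ≠ T) (hS : radius S < t) (hT : radius T ≤ t)
    (hgap : gap S T t v = 0) (hslope : 0 < ⟪gapVec S T t, Complex.I * v⟫) :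
    v = meetDir S T 1 t := by
  rw [eq_meetDir_iff (one_pow 2) hST hS hT, ← inner_gapVec_I_mul_sq hgap, Real.sqrt_sq hslope.le,
    one_mul]
  exact ⟨hgap, rfl⟩

lemma collidingMeets_meetDir (h₂₁ : S₂ ≠ S₁) (h₂₃ : S₂ ≠ S₃) (hab : a < b) (hS₁ : radius S₁ ≤ a)
    (hS₂ : radius S₂ < a) (hS₃ : radius S₃ ≤ a) (hgap₁ : gap S₂ S₁ b v = 0)
    (hgap₃ : gap S₂ S₃ b v = 0) (hslope₁ : ⟪gapVec S₂ S₁ b, Complex.I * v⟫ < 0)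
    (hslope₃ : 0 < ⟪gapVec S₂ S₃ b, Complex.I * v⟫)
    (hfirst : ∀ t ∈ Set.Ico a b, ∀ e : Circle, gap S₂ S₁ t e = 0 → gap S₂ S₃ t e ≠ 0) :
    CollidingMeets S₁ S₂ S₃ a b (meetDir S₂ S₁ (-1)) (meetDir S₂ S₃ 1) := by
  have hneg : (-1 : ℝ) ^ 2 = 1 := by norm_num
  have hone : (1 : ℝ) ^ 2 = 1 := one_pow 2
  have hlt₂ : ∀ t ∈ Set.Icc a b, radius S₂ < t := fun t ht => hS₂.trans_le ht.1
  have hle₁ : ∀ t ∈ Set.Icc a b, radius S₁ ≤ t := fun t ht => hS₁.trans ht.1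
  have hle₃ : ∀ t ∈ Set.Icc a b, radius S₃ ≤ t := fun t ht => hS₃.trans ht.1
  have hgap_left : ∀ t ∈ Set.Icc a b, gap S₂ S₁ t (meetDir S₂ S₁ (-1) t) = 0 :=
    fun t ht => gap_meetDir hneg h₂₁ (hlt₂ t ht) (hle₁ t ht)
  have hgap_right : ∀ t ∈ Set.Icc a b, gap S₂ S₃ t (meetDir S₂ S₃ 1 t) = 0 :=
    fun t ht => gap_meetDir hone h₂₃ (hlt₂ t ht) (hle₃ t ht)
  have hb : b ∈ Set.Icc a b := Set.right_mem_Icc.2 hab.le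
  have hend₁ := eq_meetDir_neg_one h₂₁ (hlt₂ b hb) (hle₁ b hb) hgap₁ hslope₁
  have hend₃ := eq_meetDir_one h₂₃ (hlt₂ b hb) (hle₃ b hb) hgap₃ hslope₃
  refine ⟨continuousOn_meetDir hneg h₂₁ hlt₂ hle₁, continuousOn_meetDir hone h₂₃ hlt₂ hle₃,
    hend₁.symm.trans hend₃, hgap_left, hgap_right,
    fun t ht hzero => hfirst t ht _ hzero (hgap_right t (Set.Ico_subset_Icc_self ht)),
    fun t ht => hfirst t ht _ (hgap_left t (Set.Ico_subset_Icc_self ht)),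
    fun t ht => ?_, fun t ht => ?_, hend₁ ▸ hslope₁, hend₃ ▸ hslope₃⟩
  · rw [inner_gapVec_I_mul_meetDir hneg h₂₁ (hlt₂ t ht) (hle₁ t ht), neg_one_mul, neg_nonpos]
    exact Real.sqrt_nonneg _
  · rw [inner_gapVec_I_mul_meetDir hone h₂₃ (hlt₂ t ht) (hle₃ t ht), one_mul]
    exact Real.sqrt_nonneg _

/-- The ellipse of a site on the sweep circle is a segment, so that it is not outside the one of
`S₂` in any direction. -/
lemma CollidingMeets.movingArc_of_radius_eq {e₁ e₃ : ℝ → Circle}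
    (h : CollidingMeets S₁ S₂ S₃ a b e₁ e₃) (hab : a < b) (hS₂ : radius S₂ ≤ a)
    (ha : radius S₁ = a ∨ radius S₃ = a) : MovingArc S₁ S₂ S₃ a b e₁ e₃ := by
  have hmem : a ∈ Set.Ico a b := Set.left_mem_Ico.2 hab
  refine h.movingArc hab (ha.imp (fun hS₁ => ?_) fun hS₃ => ?_)
  · exact (gap_nonpos_of_radius_eq hS₂ hS₁ _).lt_of_ne (h.gap_left_ne a hmem)
  · exact (gap_nonpos_of_radius_eq hS₂ hS₃ _).lt_of_ne (h.gap_right_ne a hmem)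

end MeetDir

section ClockwiseTriple

variable {V S T S₁ S₂ S₃ : Hyp} {t : ℝ} {e : Circle}

lemma mem_beachEllipse_radius_add_hdist (V S : Hyp) : V ∈ beachEllipse (radius V + hdist V S) S :=
  (add_sub_cancel_left _ _).symm

lemma ellipsePoint_radius_add_hdist (hS : radius S < radius V + hdist V S) :
    ellipsePoint (radius V + hdist V S) S (unitDir V) = V :=
  (eq_ellipsePoint_of_mem hS (mem_beachEllipse_radius_add_hdist V S)).symm

lemma gap_unitDir_eq_zero (hST : hdist V T = hdist V S) (hS : radius S < radius V + hdist V S) :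
    gap S T (radius V + hdist V S) (unitDir V) = 0 := by
  rw [gap_eq_zero_iff hS, ellipsePoint_radius_add_hdist hS, ← hST]
  exact mem_beachEllipse_radius_add_hdist V T

lemma inner_gapVec_I_mul_unitDir (hST : hdist V T = hdist V S) :
    ⟪gapVec S T (radius V + hdist V S), Complex.I * unitDir V⟫ =
      4 * Real.sinh (radius V) * Real.sinh (hdist V S) ^ 2 * Real.sin (clockAngle V S / 2) *
        Real.sin (clockAngle V T / 2) * Real.sin ((clockAngle V T - clockAngle V S) / 2) := by
  have hT := cosh_radius_add_sub_timeCoord V T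
  have hsin (U : Hyp) : Real.sin (clockAngle V U) =
      2 * Real.sin (clockAngle V U / 2) * Real.cos (clockAngle V U / 2) := by
    rw [← Real.sin_two_mul, mul_div_cancel₀ _ two_ne_zero]
  rw [hST] at hT
  rw [inner_gapVec, inner_spaceCoord_I_mul_eq_clockAngle, inner_spaceCoord_I_mul_eq_clockAngle,
    cosh_radius_add_sub_timeCoord, hT, hST, hsin S, hsin T, sub_div, Real.sin_sub]
  ring

/-- Three sites on a circle with centre `V ≠ O`, in the order in which they are met, after the far
point of the circle, when it is traversed clockwise from there. -/
structure ClockwiseTriple (V S₁ S₂ S₃ : Hyp) : Prop where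
  centre_ne_zero : V ≠ 0
  hdist_left : hdist V S₁ = hdist V S₂
  hdist_right : hdist V S₃ = hdist V S₂
  pos_left : 0 < clockAngle V S₁
  lt_left : clockAngle V S₁ < clockAngle V S₂
  lt_right : clockAngle V S₂ < clockAngle V S₃

namespace ClockwiseTriple

lemma ne_left (h : ClockwiseTriple V S₁ S₂ S₃) : S₂ ≠ S₁ :=
  fun heq => h.lt_left.ne (congrArg (clockAngle V) heq.symm)

lemma ne_right (h : ClockwiseTriple V S₁ S₂ S₃) : S₂ ≠ S₃ :=
  fun heq => h.lt_right.ne (congrArg (clockAngle V) heq)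

lemma hdist_pos (h : ClockwiseTriple V S₁ S₂ S₃) : 0 < hdist V S₂ := by
  by_cases hV : V = S₂
  · exact h.hdist_left ▸ HypSweep.hdist_pos (hV ▸ h.ne_left)
  · exact HypSweep.hdist_pos hV

lemma radius_left_lt (h : ClockwiseTriple V S₁ S₂ S₃) :
    radius S₁ < radius V + hdist V S₂ :=
  h.hdist_left ▸ radius_lt_radius_add_hdist h.centre_ne_zero (h.hdist_left ▸ h.hdist_pos)
    h.pos_left

lemma radius_right_lt (h : ClockwiseTriple V S₁ S₂ S₃) :
    radius S₃ < radius V + hdist V S₂ :=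
  h.hdist_right ▸ radius_lt_radius_add_hdist h.centre_ne_zero (h.hdist_right ▸ h.hdist_pos)
    (h.pos_left.trans (h.lt_left.trans h.lt_right))

lemma radius_middle_lt_max (h : ClockwiseTriple V S₁ S₂ S₃) :
    radius S₂ < max (radius S₁) (radius S₃) :=
  radius_lt_max_of_clockAngle_lt h.centre_ne_zero h.hdist_pos h.hdist_left h.hdist_right h.pos_left
    h.lt_left h.lt_right

lemma radius_middle_lt (h : ClockwiseTriple V S₁ S₂ S₃) :
    radius S₂ < radius V + hdist V S₂ :=
  h.radius_middle_lt_max.trans (max_lt h.radius_left_lt h.radius_right_lt)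

lemma slope_factor_pos (h : ClockwiseTriple V S₁ S₂ S₃) (hα : 0 < clockAngle V T) :
    0 < 4 * Real.sinh (radius V) * Real.sinh (hdist V S₂) ^ 2 * Real.sin (clockAngle V S₂ / 2) *
      Real.sin (clockAngle V T / 2) := by
  have hV := Real.sinh_pos_iff.2 (radius_pos.2 h.centre_ne_zero)
  have hR := Real.sinh_pos_iff.2 h.hdist_pos
  have hS₂ := sin_half_clockAngle_pos (h.pos_left.trans h.lt_left)
  have hT := sin_half_clockAngle_pos hα
  positivity

lemma slope_left_neg (h : ClockwiseTriple V S₁ S₂ S₃) :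
    ⟪gapVec S₂ S₁ (radius V + hdist V S₂), Complex.I * unitDir V⟫ < 0 := by
  have hlt : clockAngle V S₂ < 2 * Real.pi := (mod2pi_mem_Ico _).2
  rw [inner_gapVec_I_mul_unitDir h.hdist_left]
  exact mul_neg_of_pos_of_neg (h.slope_factor_pos h.pos_left)
    (Real.sin_neg_of_neg_of_neg_pi_lt (by linarith [h.lt_left]) (by linarith [h.pos_left]))

lemma slope_right_pos (h : ClockwiseTriple V S₁ S₂ S₃) :
    0 < ⟪gapVec S₂ S₃ (radius V + hdist V S₂), Complex.I * unitDir V⟫ := by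
  have hpos := h.pos_left.trans h.lt_left
  have hlt : clockAngle V S₃ < 2 * Real.pi := (mod2pi_mem_Ico _).2
  rw [inner_gapVec_I_mul_unitDir h.hdist_right]
  exact mul_pos (h.slope_factor_pos (hpos.trans h.lt_right))
    (Real.sin_pos_of_pos_of_lt_pi (by linarith [h.lt_right]) (by linarith))

/-- A common point of the three ellipses is equidistant from the sites, so that it is `V`. -/
lemma gap_right_ne_zero (h : ClockwiseTriple V S₁ S₂ S₃) (hS₂ : radius S₂ < t)
    (ht : t < radius V + hdist V S₂) (hgap : gap S₂ S₁ t e = 0) : gap S₂ S₃ t e ≠ 0 := by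
  intro hgap₃
  have h₁ : hdist _ S₁ = _ := (gap_eq_zero_iff hS₂).1 hgap
  have h₂ : hdist _ S₂ = _ := ellipsePoint_mem_beachEllipse hS₂ e
  have h₃ : hdist _ S₃ = _ := (gap_eq_zero_iff hS₂).1 hgap₃
  have hne : S₁ ≠ S₃ := fun heq =>
    (h.lt_left.trans h.lt_right).ne (congrArg (clockAngle V) heq)
  have hV : ellipsePoint t S₂ e = V := eq_of_equidistant h.ne_left h.ne_right hne
    (h₁.trans h₂.symm) (h₃.trans h₂.symm) h.hdist_left h.hdist_right
  rw [hV] at h₂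
  linarith

lemma movingArc (h : ClockwiseTriple V S₁ S₂ S₃) : MovingArc S₁ S₂ S₃ (max (radius S₁) (radius S₃))
    (radius V + hdist V S₂) (meetDir S₂ S₁ (-1)) (meetDir S₂ S₃ 1) := by
  have hlt := max_lt h.radius_left_lt h.radius_right_lt
  exact (collidingMeets_meetDir h.ne_left h.ne_right hlt (le_max_left _ _) h.radius_middle_lt_max
    (le_max_right _ _) (gap_unitDir_eq_zero h.hdist_left h.radius_middle_lt)
    (gap_unitDir_eq_zero h.hdist_right h.radius_middle_lt) h.slope_left_neg h.slope_right_pos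
    fun t ht _ => h.gap_right_ne_zero (h.radius_middle_lt_max.trans_le ht.1) ht.2
    ).movingArc_of_radius_eq hlt h.radius_middle_lt_max.le
      ((max_choice _ _).imp Eq.symm Eq.symm)

lemma meetDir_left_eq (h : ClockwiseTriple V S₁ S₂ S₃) :
    meetDir S₂ S₁ (-1) (radius V + hdist V S₂) = unitDir V :=
  (eq_meetDir_neg_one h.ne_left h.radius_middle_lt h.radius_left_lt.le
    (gap_unitDir_eq_zero h.hdist_left h.radius_middle_lt) h.slope_left_neg).symm

lemma meetDir_right_eq (h : ClockwiseTriple V S₁ S₂ S₃) :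
    meetDir S₂ S₃ 1 (radius V + hdist V S₂) = unitDir V :=
  (eq_meetDir_one h.ne_right h.radius_middle_lt h.radius_right_lt.le
    (gap_unitDir_eq_zero h.hdist_right h.radius_middle_lt) h.slope_right_pos).symm

end ClockwiseTriple

lemma gap_unitDir_neg (hS : radius S < radius V + hdist V S) (hT : hdist V S < hdist V T) :
    gap S T (radius V + hdist V S) (unitDir V) < 0 := by
  rwa [gap_neg_iff hS, ← radius_ellipsePoint hS, ellipsePoint_radius_add_hdist hS,
    add_sub_cancel_left]

end ClockwiseTriple

lemma exists_eq_insert_lt_lt {α : Type*} {s : Set α} (f : α → ℝ) (hs : s.ncard = 3)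
    (hf : Set.InjOn f s) : ∃ a b c, s = {a, b, c} ∧ f a < f b ∧ f b < f c := by
  have hfin := Set.finite_of_ncard_pos (hs ▸ three_pos)
  obtain ⟨a, ha, hmin⟩ := s.exists_min_image f hfin (Set.nonempty_of_ncard_ne_zero (by omega))
  have hcard : (s \ {a}).ncard = 2 := by rw [Set.ncard_sdiff_singleton_of_mem ha, hs]
  obtain ⟨b, c, hbc, heq⟩ := Set.ncard_eq_two.1 hcard
  have hlt : ∀ x ∈ ({b, c} : Set α), f a < f x := fun x hx => by
    obtain ⟨hxs, hxa⟩ := heq ▸ hx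
    exact (hmin x hxs).lt_of_ne fun h => hxa (hf ha hxs h).symm
  have hb : b ∈ s \ {a} := heq ▸ Set.mem_insert b _
  have hc : c ∈ s \ {a} := heq ▸ Set.mem_insert_of_mem b rfl
  have hs' : s = {a, b, c} := by rw [← heq, Set.insert_sdiff_singleton, Set.insert_eq_of_mem ha]
  rcases lt_or_gt_of_ne (hf.ne hb.1 hc.1 hbc) with h | h
  · exact ⟨a, b, c, hs', hlt b (Set.mem_insert b _), h⟩
  · exact ⟨a, c, b, Set.pair_comm b c ▸ hs', hlt c (Set.mem_insert_of_mem b rfl), h⟩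

section IncidenceTuple

variable {𝒮 : Finset Hyp} {V V' S T S₁ S₂ S₃ : Hyp} {r : ℝ}

lemma hdist_pos_of_mem_incidentSites (hV : IsVoronoiVertex 𝒮 V) (hS : S ∈ incidentSites 𝒮 V) :
    0 < hdist V S := by
  obtain ⟨A, B, C, hAB, -, -, hsub⟩ := isVoronoiVertex_iff.1 hV
  simp only [Set.insert_subset_iff, Set.singleton_subset_iff] at hsub
  by_cases hVA : V = A
  · exact hdist_eq_of_mem_incidentSites hsub.2.1 hS ▸ hdist_pos (hVA ▸ hAB)
  · exact hdist_eq_of_mem_incidentSites hsub.1 hS ▸ hdist_pos hVA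

lemma exists_incidenceTuple (hV : IsVoronoiVertex 𝒮 V) (hV' : IsFarPoint 𝒮 V V')
    (hthree : (incidentSites 𝒮 V).ncard ≤ 3) (hpole : V ≠ 0) (hfar : V' ∉ 𝒮) :
    ∃ S₁ S₂ S₃, IsIncidenceTuple 𝒮 V V' S₁ S₂ S₃ ∧ ClockwiseTriple V S₁ S₂ S₃ := by
  obtain ⟨S₁, S₂, S₃, hinc, h₁₂, h₂₃⟩ := exists_eq_insert_lt_lt (clockAngle V)
    (le_antisymm hthree hV) fun S hS T hT =>
      eq_of_hdist_eq_of_clockAngle_eq (hdist_eq_of_mem_incidentSites hS hT)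
  have hS₁ : S₁ ∈ incidentSites 𝒮 V := hinc ▸ Set.mem_insert _ _
  have hS₂ : S₂ ∈ incidentSites 𝒮 V := hinc ▸ Or.inr (Or.inl rfl)
  have hS₃ : S₃ ∈ incidentSites 𝒮 V := hinc ▸ Or.inr (Or.inr rfl)
  have hd := hdist_pos_of_mem_incidentSites hV hS₁
  have hV'_eq := hV'.eq_outward hS₁ hpole
  refine ⟨S₁, S₂, S₃, ⟨hinc, ?_, ?_⟩, hpole, hdist_eq_of_mem_incidentSites hS₁ hS₂,
    hdist_eq_of_mem_incidentSites hS₃ hS₂,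
    clockAngle_pos hd fun h => hfar (hV'_eq ▸ h ▸ hS₁.1), h₁₂, h₂₃⟩
  all_goals rwa [hV'_eq, cwAngle_outward V _ hd, cwAngle_outward V _ hd]

lemma hdist_lt_of_notMem_incidentSites (hS : S ∈ incidentSites 𝒮 V) (hT : T ∈ 𝒮)
    (hTV : T ∉ incidentSites 𝒮 V) : hdist V S < hdist V T :=
  lt_of_not_ge fun hle => hTV ⟨hT, fun U hU => hle.trans (hS.2 U hU)⟩

lemma ClockwiseTriple.clearArc (h : ClockwiseTriple V S₁ S₂ S₃)
    (hinc : incidentSites 𝒮 V = {S₁, S₂, S₃})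
    (hr : IsGreatest {q | q ∈ eventRadii 𝒮 ∧ q < radius V + hdist V S₂} r) :
    ClearArc 𝒮 S₁ S₂ S₃ r (radius V + hdist V S₂) (meetDir S₂ S₁ (-1)) (meetDir S₂ S₃ 1) := by
  have hS₁ : S₁ ∈ incidentSites 𝒮 V := hinc ▸ Set.mem_insert _ _
  have hS₂ : S₂ ∈ incidentSites 𝒮 V := hinc ▸ Or.inr (Or.inl rfl)
  have hS₃ : S₃ ∈ incidentSites 𝒮 V := hinc ▸ Or.inr (Or.inr rfl)
  have hmax : max (radius S₁) (radius S₃) ≤ r :=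
    max_le (hr.2 ⟨radius_mem_eventRadii hS₁.1, h.radius_left_lt⟩)
      (hr.2 ⟨radius_mem_eventRadii hS₃.1, h.radius_right_lt⟩)
  refine ⟨h.movingArc.mono hmax, hS₁.1, hS₂.1, hS₃.1, h.ne_left, h.ne_right,
    h.radius_middle_lt_max.trans_le hmax, ?_, fun q hq hevent => (hr.2 ⟨hevent, hq.2⟩).not_gt hq.1⟩
  rintro T ⟨hT, hTV⟩
  rw [h.meetDir_left_eq]
  exact gap_unitDir_neg h.radius_middle_lt (hdist_lt_of_notMem_incidentSites hS₂ hT (hinc ▸ hTV))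

end IncidenceTuple

end HypSweep

open HypSweep in
theorem mainTheorem2 (𝒮 : Finset Hyp) (V V' : Hyp)
    (hV : IsVoronoiVertex 𝒮 V) (hV' : IsFarPoint 𝒮 V V')
    (hthree : (incidentSites 𝒮 V).ncard ≤ 3)
    (hpole : V ≠ 0) (hfar : V' ∉ 𝒮) :
    ∃ S₁ S₂ S₃ : Hyp, IsIncidenceTuple 𝒮 V V' S₁ S₂ S₃ ∧
    ∃ r : ℝ, IsGreatest {q | q ∈ eventRadii 𝒮 ∧ q < radius V'} r ∧
    ∃ I₁₂ I₂₃ : ℝ → Hyp,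
      ContinuousOn I₁₂ (Set.Icc r (radius V')) ∧ ContinuousOn I₂₃ (Set.Icc r (radius V')) ∧
      I₁₂ (radius V') = V ∧ I₂₃ (radius V') = V ∧
      ∀ t ∈ Set.Icc r (radius V'),
        I₁₂ t ∈ beachEllipse t S₁ ∩ beachEllipse t S₂ ∧
        I₂₃ t ∈ beachEllipse t S₂ ∩ beachEllipse t S₃ ∧
        (t < radius V' →
          Consecutive 𝒮 t (I₁₂ t) (I₂₃ t) ∧
          ∀ X ∈ beachCurve 𝒮 t, StrictlyBetween (I₁₂ t) X (I₂₃ t) → X ∈ activePart 𝒮 t S₂) := by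
  obtain ⟨S₁, S₂, S₃, htuple, htriple⟩ := exists_incidenceTuple hV hV' hthree hpole hfar
  have hS₂ : S₂ ∈ incidentSites 𝒮 V := htuple.1 ▸ Or.inr (Or.inl rfl)
  have hradius : radius V' = radius V + hdist V S₂ := hV'.radius_eq hS₂
  obtain ⟨r, hr⟩ := exists_isGreatest_eventRadii 𝒮 (b := radius V')
    (hradius ▸ (radius_nonneg S₂).trans_lt htriple.radius_middle_lt)
  refine ⟨S₁, S₂, S₃, htuple, r, hr, fun t => ellipsePoint t S₂ (meetDir S₂ S₁ (-1) t),
    fun t => ellipsePoint t S₂ (meetDir S₂ S₃ 1 t), ?_⟩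
  rw [hradius] at hr ⊢
  have harc := htriple.clearArc htuple.1 hr
  have hlt : ∀ t ∈ Set.Icc r (radius V + hdist V S₂), radius S₂ < t :=
    fun t ht => harc.radius_lt.trans_le ht.1
  have hend := ellipsePoint_radius_add_hdist htriple.radius_middle_lt
  exact ⟨continuousOn_ellipsePoint harc.continuousOn_left hlt,
    continuousOn_ellipsePoint harc.continuousOn_right hlt,
    (congrArg _ htriple.meetDir_left_eq).trans hend,
    (congrArg _ htriple.meetDir_right_eq).trans hend,
    fun t ht => ⟨harc.mem_beachEllipse_left ht, harc.mem_beachEllipse_right ht, fun hlt_end =>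
      ⟨harc.consecutive ⟨ht.1, hlt_end⟩, fun X hX => harc.mem_activePart ⟨ht.1, hlt_end⟩ hX⟩⟩⟩
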